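/- Let $V:\mathbb{R}\to[0,\infty)$ be an Orlicz function, i.e. convex and symmetric with $V(0)=0$ and $V(x)>0$ for $x\neq 0$. Let $p\in(1,\infty)$ be such that $V(x)/|x|^p\to\infty$ as $|x|\to\infty$, let $R\in(0,\infty)$, and for each $n\in\mathbb{N}$, $n\ge 1$, let $X_R^{n,V}$ be uniformly distributed on the Orlicz ball $\mathbb{B}_R^{n,V}=\{x\in\mathbb{R}^n:\sum_{k=1}^n V(x_k)\le Rn\}$. For a Borel probability measure $\nu$ on $\mathbb{R}$ write $m_V(\nu)=\int V\,d\nu$ and $m_p(\nu)=\int|x|^p\,\nu(dx)$, both in $[0,\infty]$, and let $h(\nu)=-\int_{\mathbb{R}}\log\frac{d\nu}{dx}(x)\,\nu(dx)$ if $\nu$ has a Lebesgue density $\frac{d\nu}{dx}$ and $h(\nu)=-\infty$ otherwise (if $m_V(\nu)<\infty$, then $h(\nu)\in[-\infty,\infty)$ is well defined). Define $J_p^V:\mathbb{R}\to[0,\infty]$ by $$ J_p^V(x)=\begin{cases}-\max_{\alpha<0}\Big\{\alpha R-\log\int_{\mathbb{R}}e^{\alpha V(t)}\,dt\Big\}-\max\Big\{h(\nu):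 m_p(\nu)^{1/p}=x,\ m_V(\nu)\le R\Big\}&: x\ge 0,\\ \infty&: x<0,\end{cases} $$ where the maximum over the empty set is $-\infty$. Then the first maximum is attained, the second one is attained whenever the set of admissible $\nu$ is non-empty, and the sequence $\big(n^{-1/p}\|X_R^{n,V}\|_p\big)_{n\in\mathbb{N}}$ satisfies a large deviation principle in $\mathbb{R}$ with good rate function $J_p^V$. That is, $J_p^V\geq 0$, the sets $\{J_p^V\le a\}$, $a\in\mathbb{R}$, are compact, and for every Borel set $A\subseteq\mathbb{R}$, with interior $A^\circ$ and closure $\overline{A}$, $$ -\inf_{x\in A^\circ}J_p^V(x)\le\liminf_{n\to\infty}\tfrac1n\log\mathbb{P}\big[n^{-1/p}\|X_R^{n,V}\|_p\in A^\circ\big]\le\limsup_{n\to\infty}\tfrac1n\log\mathbb{P}\big[n^{-1/p}\|X_R^{n,V}\|_p\in\overline{A}\big]\le-\inf_{x\in\overline{A}}J_p^V(x). $$ -/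

import Mathlib

open MeasureTheory ProbabilityTheory Filter Topology
open scoped ENNReal

noncomputable section

/-- An Orlicz function: convex, symmetric, vanishing at `0` and positive elsewhere. -/
structure IsOrlicz (V : ℝ → ℝ) : Prop where
  convexOn : ConvexOn ℝ Set.univ V
  symm : ∀ x, V (-x) = V x
  map_zero : V 0 = 0
  pos : ∀ x, x ≠ 0 → 0 < V x

/-- The Orlicz ball `{x ∈ ℝⁿ : ∑ₖ V(xₖ) ≤ R n}`. -/
def orliczBall (V : ℝ → ℝ) (R : ℝ) (n : ℕ) : Set (Fin n → ℝ) :=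
  {x | ∑ k, V (x k) ≤ R * n}

/-- The moment `m_V(ν) = ∫ V dν ∈ [0, ∞]` of a nonnegative function `V`. -/
def moment_of (V : ℝ → ℝ) (ν : ProbabilityMeasure ℝ) : ℝ≥0∞ :=
  ∫⁻ x, ENNReal.ofReal (V x) ∂(ν : Measure ℝ)

open Classical in
/-- The differential entropy `h(ν) = -∫ log (dν/dx) dν`, with value in `[-∞, ∞]`. The integral is
the difference of the integrals of the positive and negative parts of `-log (dν/dx)`, where
`∞ - ∞` is `-∞` by the convention of `EReal`. It is `-∞` if `ν` has no Lebesgue density. -/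
def diffEntropy (ν : ProbabilityMeasure ℝ) : EReal :=
  if (ν : Measure ℝ) ≪ volume then
    ((∫⁻ x, ENNReal.ofReal (-Real.log ((ν : Measure ℝ).rnDeriv volume x).toReal)
        ∂(ν : Measure ℝ) : ℝ≥0∞) : EReal)
      - ((∫⁻ x, ENNReal.ofReal (Real.log ((ν : Measure ℝ).rnDeriv volume x).toReal)
        ∂(ν : Measure ℝ) : ℝ≥0∞) : EReal)
  else ⊥

/-- A good rate function: `[0, ∞]`-valued with compact sublevel sets. -/
structure IsGoodRateFunction {E : Type*} [TopologicalSpace E] (I : E → EReal) : Prop where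
  nonneg : ∀ x, 0 ≤ I x
  isCompact_sublevel : ∀ a : ℝ, IsCompact {x | I x ≤ (a : EReal)}

/-- The random variables `ξ n : Ω n → E` satisfy a large deviation principle (speed `n`) with good
rate function `I`. Probabilities of a Borel set enter through
`ENNReal.log (P n (ξ n ⁻¹' A)) / n ∈ [-∞, 0]`, with `log 0 = -∞`. -/
structure SatisfiesLDP {E : Type*} [TopologicalSpace E] [MeasurableSpace E]
    {Ω : ℕ → Type*} [∀ n, MeasurableSpace (Ω n)] (P : ∀ n, Measure (Ω n))
    (ξ : ∀ n, Ω n → E) (I : E → EReal) : Prop where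
  isGoodRateFunction : IsGoodRateFunction I
  lower : ∀ A : Set E, MeasurableSet A →
    -(⨅ x ∈ interior A, I x) ≤
      liminf (fun n : ℕ => ENNReal.log (P n (ξ n ⁻¹' interior A)) / (n : EReal)) atTop
  upper : ∀ A : Set E, MeasurableSet A →
    limsup (fun n : ℕ => ENNReal.log (P n (ξ n ⁻¹' closure A)) / (n : EReal)) atTop ≤
      -(⨅ x ∈ closure A, I x)

/-- The function `α ↦ α R - log ∫ exp (α V(t)) dt` (considered for `α < 0`). -/
def gibbsDual (V : ℝ → ℝ) (R α : ℝ) : ℝ :=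
  α * R - Real.log (∫ t, Real.exp (α * V t))

/-- The laws `ν` with `m_p(ν)^(1/p) = x` and `m_V(ν) ≤ R` (for `x ≥ 0`). -/
def entropyConstraint (V : ℝ → ℝ) (p R x : ℝ) : Set (ProbabilityMeasure ℝ) :=
  {ν | moment_of (fun t => |t| ^ p) ν ^ (1 / p) = ENNReal.ofReal x ∧
    moment_of V ν ≤ ENNReal.ofReal R}

open Classical in
/-- The rate function: for `x ≥ 0`,
`-max_{α < 0} (α R - log ∫ exp (α V)) - max {h(ν) : m_p(ν)^(1/p) = x, m_V(ν) ≤ R}`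
(the maximum over the empty set being `-∞`), and `∞` for `x < 0`. -/
def thinShellRate (V : ℝ → ℝ) (p R x : ℝ) : EReal :=
  if 0 ≤ x then
    -(⨆ α ∈ Set.Iio (0 : ℝ), (gibbsDual V R α : EReal))
      - (⨆ ν ∈ entropyConstraint V p R x, diffEntropy ν)
  else ⊤

end

/-!
Boltzmann's principle: the part of the Orlicz ball on which the empirical mean of `w = |·| ^ p` is
close to `y` has volume `exp (n * H y + o(n))`, where `H y` is the largest entropy of a density `f`
with `∫ w f = y` and `∫ V f ≤ R`. For the upper bound, the uniform distribution on the part `A` of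
the ball where the empirical mean lies in a closed interval has an average marginal `f` with
`∫ V f ≤ R` and `∫ w f` in that interval, and subadditivity of entropy gives
`log (volume A) ≤ n * h(f)`. For the lower bound, shrink a competitor `f` so that `∫ V f < R`; by
the law of large numbers almost all the mass of the `n`-fold product of `f` lies in the ball, at
points where the product density is about `exp (-n * h(f))`. With `w = 0` the same bounds give the
volume of the whole ball, where Gibbs' inequality identifies the maximal entropy as
`-max_{α < 0} gibbsDual V R α`.

Attainment of the maximum and goodness of the rate function both follow from the hypograph of `H`
being closed. Let densities `f_k` have moments tending to `y` and entropies tending to the largest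
limit possible for such a sequence. Midpoints `(f_j + f_k) / 2` cannot do better in the limit, and
they gain at least a quarter of the squared Hellinger distance in entropy, so `√f_k` is Cauchy in
`L²`. The assumption `w = o(V)` keeps the `w`-moment from escaping to infinity.
-/

/-! ### Orlicz functions -/

namespace IsOrlicz

variable {V w : ℝ → ℝ}

theorem continuous (hV : IsOrlicz V) : Continuous V :=
  continuousOn_univ.1 (hV.convexOn.continuousOn isOpen_univ)

theorem nonneg (hV : IsOrlicz V) (x : ℝ) : 0 ≤ V x := by
  rcases eq_or_ne x 0 with rfl | hx
  · exact hV.map_zero.ge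
  · exact (hV.pos x hx).le

theorem apply_abs (hV : IsOrlicz V) (x : ℝ) : V |x| = V x := by
  rcases abs_choice x with h | h <;> rw [h]
  exact hV.symm x

theorem apply_mul_le (hV : IsOrlicz V) {l : ℝ} (h0 : 0 ≤ l) (h1 : l ≤ 1) (x : ℝ) :
    V (l * x) ≤ l * V x := by
  have := hV.convexOn.2 (Set.mem_univ x) (Set.mem_univ 0) h0 (sub_nonneg.2 h1) (by ring)
  simpa [hV.map_zero] using this

theorem apply_le_of_abs_le (hV : IsOrlicz V) {x T : ℝ} (h : |x| ≤ |T|) : V x ≤ V T := by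
  rcases (abs_nonneg T).eq_or_lt with hT | hT
  · rw [← hT, abs_nonpos_iff] at h
    simpa [h, hV.map_zero] using hV.nonneg T
  · have hl : |x| / |T| ≤ 1 := (div_le_one hT).2 h
    calc V x = V (|x| / |T| * |T|) := by rw [div_mul_cancel₀ _ hT.ne', hV.apply_abs]
      _ ≤ |x| / |T| * V |T| := hV.apply_mul_le (by positivity) hl _
      _ ≤ V T := by
          rw [hV.apply_abs]
          exact mul_le_of_le_one_left (hV.nonneg T) hl

theorem mul_abs_le (hV : IsOrlicz V) (t : ℝ) : V 1 * |t| ≤ V t + V 1 := by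
  rcases le_total |t| 1 with ht | ht
  · linarith [mul_le_of_le_one_right (hV.nonneg 1) ht, hV.nonneg t]
  · have h0 : 0 < |t| := by linarith
    have h := hV.apply_mul_le (by positivity) (inv_le_one_of_one_le₀ ht) |t|
    rw [inv_mul_cancel₀ h0.ne', hV.apply_abs, inv_mul_eq_div, le_div_iff₀ h0] at h
    linarith [hV.nonneg 1]

theorem exists_abs_le_mul_add (hV : IsOrlicz V) (hwc : Continuous w) (hw : w =o[cocompact ℝ] V)
    {ε : ℝ} (hε : 0 < ε) : ∃ C, ∀ t, |w t| ≤ ε * V t + C := by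
  obtain ⟨K, hK, hKs⟩ := mem_cocompact.1 (hw.bound hε)
  obtain ⟨C, hC⟩ := hK.exists_bound_of_continuousOn hwc.continuousOn
  refine ⟨|C|, fun t => ?_⟩
  by_cases ht : t ∈ K
  · linarith [hC t ht, le_abs_self C, mul_nonneg hε.le (hV.nonneg t), Real.norm_eq_abs (w t)]
  · have h : |w t| ≤ ε * |V t| := hKs ht
    rw [abs_of_nonneg (hV.nonneg t)] at h
    linarith [abs_nonneg C]

theorem isLittleO_abs_rpow (hV : IsOrlicz V) {p : ℝ}
    (hVp : Tendsto (fun x : ℝ => V x / |x| ^ p) (cocompact ℝ) atTop) :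
    (fun x => |x| ^ p) =o[cocompact ℝ] V := by
  have hne : ∀ᶠ x : ℝ in cocompact ℝ, x ≠ 0 :=
    (isCompact_singleton (x := (0 : ℝ))).compl_mem_cocompact
  refine (Asymptotics.isLittleO_iff_tendsto' ?_).2
    (hVp.inv_tendsto_atTop.congr fun x => inv_div _ _)
  exact hne.mono fun x hx h => absurd h (hV.pos x hx).ne'

end IsOrlicz

theorem integrable_exp_mul_abs_of_neg {a : ℝ} (ha : a < 0) :
    Integrable (fun t : ℝ => Real.exp (a * |t|)) := by
  rw [← integrableOn_univ, ← Set.Iic_union_Ioi (a := (0 : ℝ)), integrableOn_union]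
  constructor
  · refine (integrableOn_exp_mul_Iic (neg_pos.2 ha) 0).congr_fun (fun t ht => ?_) measurableSet_Iic
    beta_reduce
    rw [abs_of_nonpos ht, mul_neg, neg_mul]
  · refine (integrableOn_exp_mul_Ioi ha 0).congr_fun (fun t ht => ?_) measurableSet_Ioi
    rw [abs_of_pos ht]

theorem IsOrlicz.integrable_exp_mul {V : ℝ → ℝ} (hV : IsOrlicz V) {α : ℝ} (hα : α < 0) :
    Integrable (fun t : ℝ => Real.exp (α * V t)) := by
  have hc := hV.continuous
  have hα1 : α * V 1 < 0 := mul_neg_of_neg_of_pos hα (hV.pos 1 one_ne_zero)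
  refine ((integrable_exp_mul_abs_of_neg hα1).const_mul (Real.exp (-(α * V 1)))).mono'
    (by fun_prop) (Eventually.of_forall fun t => ?_)
  rw [Real.norm_eq_abs, Real.abs_exp, ← Real.exp_add, Real.exp_le_exp]
  nlinarith [hV.mul_abs_le t]

/-! ### The dual problem -/

section Dual

variable {V : ℝ → ℝ} {R α T : ℝ}

theorem two_mul_exp_le_integral_exp (hV : IsOrlicz V) (hα : α < 0) (hT : 0 < T) :
    2 * T * Real.exp (α * V T) ≤ ∫ t, Real.exp (α * V t) := by
  have hi := hV.integrable_exp_mul hα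
  calc 2 * T * Real.exp (α * V T) = ∫ _ in Set.Icc (-T) T, Real.exp (α * V T) := by
        rw [setIntegral_const, Measure.real, Real.volume_Icc, ENNReal.toReal_ofReal (by linarith),
          smul_eq_mul]
        ring
    _ ≤ ∫ t in Set.Icc (-T) T, Real.exp (α * V t) := by
        refine setIntegral_mono_on (by simp) hi.integrableOn measurableSet_Icc fun t ht => ?_
        have hVt : V t ≤ V T := hV.apply_le_of_abs_le ((abs_le.2 ht).trans (le_abs_self T))
        exact Real.exp_le_exp.2 (mul_le_mul_of_nonpos_left hVt hα.le)
    _ ≤ ∫ t, Real.exp (α * V t) :=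
        setIntegral_le_integral hi (Eventually.of_forall fun t => (Real.exp_pos _).le)

theorem gibbsDual_le (hV : IsOrlicz V) (hα : α < 0) (hT : 0 < T) :
    gibbsDual V R α ≤ α * (R - V T) - Real.log (2 * T) := by
  have h := Real.log_le_log (by positivity) (two_mul_exp_le_integral_exp hV hα hT)
  rw [Real.log_mul (by positivity) (Real.exp_ne_zero _), Real.log_exp] at h
  unfold gibbsDual
  linarith

theorem mem_interior_integrableExpSet (hV : IsOrlicz V) (hα : α < 0) :
    α ∈ interior (integrableExpSet V volume) :=
  isOpen_Iio.subset_interior_iff.2 (fun _ h => hV.integrable_exp_mul h) (Set.mem_Iio.2 hα)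

theorem hasDerivAt_gibbsDual (hV : IsOrlicz V) (hα : α < 0) :
    HasDerivAt (gibbsDual V R)
      (R - (∫ t, V t * Real.exp (α * V t)) / ∫ t, Real.exp (α * V t)) α := by
  have h : HasDerivAt (gibbsDual V R) _ α := ((hasDerivAt_id α).mul_const R).sub
    ((hasDerivAt_mgf (mem_interior_integrableExpSet hV hα)).log
      (integral_exp_pos (hV.integrable_exp_mul hα)).ne')
  simpa [mgf] using h

theorem tendsto_gibbsDual_nhdsLT_zero (hV : IsOrlicz V) (hR : 0 ≤ R) :
    Tendsto (gibbsDual V R) (𝓝[<] 0) atBot := by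
  refine tendsto_atBot.2 fun c => ?_
  set T : ℝ := Real.exp (1 - c) / 2
  have hVT : 0 < V T := hV.pos T (by positivity)
  filter_upwards [self_mem_nhdsWithin,
    nhdsWithin_le_nhds (Ioi_mem_nhds (neg_lt_zero.2 (one_div_pos.2 hVT)))] with α hα0 hα1
  have h := gibbsDual_le (R := R) hV hα0 (T := T) (by positivity)
  rw [show 2 * T = Real.exp (1 - c) by ring, Real.log_exp] at h
  have hαVT : -1 ≤ α * V T := by
    rw [Set.mem_Ioi, ← neg_div, div_lt_iff₀ hVT] at hα1
    exact hα1.le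
  linarith [mul_nonpos_of_nonpos_of_nonneg (le_of_lt hα0) hR]

theorem tendsto_gibbsDual_atBot (hV : IsOrlicz V) (hR : 0 < R) :
    Tendsto (gibbsDual V R) atBot atBot := by
  obtain ⟨T, hVT, hT⟩ : ∃ T : ℝ, V T < R ∧ 0 < T := by
    have h0 := hV.continuous.tendsto 0
    rw [hV.map_zero] at h0
    exact (((h0.mono_left nhdsWithin_le_nhds).eventually_lt_const hR).and
      (self_mem_nhdsWithin (s := Set.Ioi (0 : ℝ)))).exists
  have hlin : Tendsto (fun α => α * (R - V T) - Real.log (2 * T)) atBot atBot :=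
    tendsto_atBot_add_const_right _ _ (tendsto_id.atBot_mul_const (sub_pos.2 hVT))
  exact tendsto_atBot_mono' _ ((eventually_lt_atBot 0).mono fun α hα => gibbsDual_le hV hα hT) hlin

theorem exists_isMaxOn_gibbsDual (hV : IsOrlicz V) (hR : 0 < R) :
    ∃ α ∈ Set.Iio (0 : ℝ), IsMaxOn (gibbsDual V R) (Set.Iio 0) α := by
  have hcont : ContinuousOn (gibbsDual V R) (Set.Iio 0) := fun α hα =>
    (hasDerivAt_gibbsDual hV hα).continuousAt.continuousWithinAt
  obtain ⟨a, ha⟩ := eventually_atBot.1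
    ((tendsto_gibbsDual_atBot hV hR).eventually_le_atBot (gibbsDual V R (-1)))
  obtain ⟨b, hb0, hb⟩ := (mem_nhdsLT_iff_exists_Ioo_subset' (show (-1 : ℝ) < 0 by norm_num)).1
    ((tendsto_gibbsDual_nhdsLT_zero hV hR.le).eventually_le_atBot (gibbsDual V R (-1)))
  have hmem : (-1 : ℝ) ∈ Set.Icc (min a (-1)) (max b (-1)) := ⟨min_le_right _ _, le_max_right _ _⟩
  have hneg : max b (-1) < 0 := max_lt hb0 (by norm_num)
  obtain ⟨α, hα, hmax⟩ := isCompact_Icc.exists_isMaxOn ⟨-1, hmem⟩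
    (hcont.mono fun x hx => lt_of_le_of_lt hx.2 hneg)
  refine ⟨α, lt_of_le_of_lt hα.2 hneg, fun x hx => ?_⟩
  have hαmax : gibbsDual V R (-1) ≤ gibbsDual V R α := hmax hmem
  rcases le_or_gt x (min a (-1)) with hxa | hxa
  · exact (ha x (hxa.trans (min_le_left _ _))).trans hαmax
  rcases le_or_gt x (max b (-1)) with hxb | hxb
  · exact hmax ⟨hxa.le, hxb⟩
  · exact (hb ⟨(le_max_left _ _).trans_lt hxb, hx⟩ : _ ≤ _).trans hαmax

end Dual

/-! ### Probability densities and their entropy -/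

/-- `f` is a measurable, nonnegative, real-valued probability density with respect to `μ`. -/
structure IsProbDensity {E : Type*} [MeasurableSpace E] (μ : Measure E) (f : E → ℝ) : Prop where
  measurable : Measurable f
  nonneg : ∀ x, 0 ≤ f x
  integral_eq_one : ∫ x, f x ∂μ = 1

/-- The differential entropy `-∫ f log f dμ` of a density `f` with respect to `μ`, as a real number;
it is meaningful when `f log f` is integrable. -/
noncomputable def densityEntropy {E : Type*} [MeasurableSpace E] (μ : Measure E) (f : E → ℝ) : ℝ :=
  ∫ x, Real.negMulLog (f x) ∂μ

section Lintegral

variable {E : Type*} [MeasurableSpace E] {μ : Measure E} {g : E → ℝ} {c : ℝ}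

theorem lintegral_ofReal_le_ofReal_iff (hg : AEStronglyMeasurable g μ) (h0 : 0 ≤ᵐ[μ] g)
    (hc : 0 ≤ c) :
    ∫⁻ x, ENNReal.ofReal (g x) ∂μ ≤ ENNReal.ofReal c ↔ Integrable g μ ∧ ∫ x, g x ∂μ ≤ c := by
  refine ⟨fun h => ?_, fun ⟨hi, h⟩ => ?_⟩
  · have hi : Integrable g μ :=
      (lintegral_ofReal_ne_top_iff_integrable hg h0).1 (h.trans_lt ENNReal.ofReal_lt_top).ne
    rw [← ofReal_integral_eq_lintegral_ofReal hi h0, ENNReal.ofReal_le_ofReal_iff hc] at h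
    exact ⟨hi, h⟩
  · rw [← ofReal_integral_eq_lintegral_ofReal hi h0]
    exact ENNReal.ofReal_le_ofReal h

theorem lintegral_ofReal_eq_ofReal_iff (hg : AEStronglyMeasurable g μ) (h0 : 0 ≤ᵐ[μ] g)
    (hc : 0 ≤ c) :
    ∫⁻ x, ENNReal.ofReal (g x) ∂μ = ENNReal.ofReal c ↔ Integrable g μ ∧ ∫ x, g x ∂μ = c := by
  refine ⟨fun h => ?_, fun ⟨hi, h⟩ => ?_⟩
  · have hi := ((lintegral_ofReal_le_ofReal_iff hg h0 hc).1 h.le).1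
    rw [← ofReal_integral_eq_lintegral_ofReal hi h0,
      ENNReal.ofReal_eq_ofReal_iff (integral_nonneg_of_ae h0) hc] at h
    exact ⟨hi, h⟩
  · rw [← ofReal_integral_eq_lintegral_ofReal hi h0, h]

theorem integrable_of_lintegral_ofReal_ne_top (hg : AEStronglyMeasurable g μ)
    (hpos : ∫⁻ x, ENNReal.ofReal (g x) ∂μ ≠ ∞) (hneg : ∫⁻ x, ENNReal.ofReal (-g x) ∂μ ≠ ∞) :
    Integrable g μ := by
  refine ⟨hg, ?_⟩
  have hnorm : ∀ x, ENNReal.ofReal ‖g x‖ = ENNReal.ofReal (g x) + ENNReal.ofReal (-g x) := by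
    intro x
    rcases le_total 0 (g x) with h | h
    · rw [Real.norm_of_nonneg h, ENNReal.ofReal_of_nonpos (neg_nonpos.2 h), add_zero]
    · rw [Real.norm_of_nonpos h, ENNReal.ofReal_of_nonpos h, zero_add]
  rw [hasFiniteIntegral_iff_norm, lintegral_congr hnorm,
    lintegral_add_left' hg.aemeasurable.ennreal_ofReal]
  exact ENNReal.add_lt_top.2 ⟨hpos.lt_top, hneg.lt_top⟩

end Lintegral

namespace IsProbDensity

variable {E : Type*} [MeasurableSpace E] {μ : Measure E} {f g : E → ℝ}

theorem integrable (hf : IsProbDensity μ f) : Integrable f μ :=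
  integrable_of_integral_eq_one hf.integral_eq_one

theorem measurable_negMulLog (hf : IsProbDensity μ f) :
    Measurable fun x => Real.negMulLog (f x) :=
  Real.continuous_negMulLog.measurable.comp hf.measurable

theorem isProbabilityMeasure_withDensity (hf : IsProbDensity μ f) :
    IsProbabilityMeasure (μ.withDensity fun x => ENNReal.ofReal (f x)) := by
  constructor
  rw [withDensity_apply _ MeasurableSet.univ, setLIntegral_univ,
    ← ofReal_integral_eq_lintegral_ofReal hf.integrable (Eventually.of_forall hf.nonneg),
    hf.integral_eq_one, ENNReal.ofReal_one]

theorem lintegral_ofReal_withDensity (hf : IsProbDensity μ f) (hg : Measurable g) :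
    ∫⁻ x, ENNReal.ofReal (g x) ∂(μ.withDensity fun x => ENNReal.ofReal (f x))
      = ∫⁻ x, ENNReal.ofReal (g x * f x) ∂μ := by
  rw [lintegral_withDensity_eq_lintegral_mul _ hf.measurable.ennreal_ofReal hg.ennreal_ofReal]
  refine lintegral_congr fun x => ?_
  rw [Pi.mul_apply, mul_comm, ENNReal.ofReal_mul' (hf.nonneg x)]

theorem integrable_withDensity_iff (hf : IsProbDensity μ f) :
    Integrable g (μ.withDensity fun x => ENNReal.ofReal (f x)) ↔
      Integrable (fun x => g x * f x) μ := by
  rw [MeasureTheory.integrable_withDensity_iff hf.measurable.ennreal_ofReal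
    (Eventually.of_forall fun x => ENNReal.ofReal_lt_top)]
  simp only [ENNReal.toReal_ofReal (hf.nonneg _)]

theorem integral_withDensity (hf : IsProbDensity μ f) :
    ∫ x, g x ∂(μ.withDensity fun x => ENNReal.ofReal (f x)) = ∫ x, g x * f x ∂μ := by
  rw [integral_withDensity_eq_integral_toReal_smul hf.measurable.ennreal_ofReal
    (Eventually.of_forall fun x => ENNReal.ofReal_lt_top)]
  simp only [ENNReal.toReal_ofReal (hf.nonneg _), smul_eq_mul, mul_comm]

end IsProbDensity

section RnDeriv

variable {E : Type*} [MeasurableSpace E] {μ ν : Measure E} [SigmaFinite μ]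

theorem withDensity_ofReal_toReal_rnDeriv [SigmaFinite ν] (hac : ν ≪ μ) :
    (μ.withDensity fun x => ENNReal.ofReal (ν.rnDeriv μ x).toReal) = ν := by
  conv_rhs => rw [← Measure.withDensity_rnDeriv_eq _ _ hac]
  refine withDensity_congr_ae ?_
  filter_upwards [ν.rnDeriv_lt_top μ] with x hx
  exact ENNReal.ofReal_toReal hx.ne

theorem isProbDensity_toReal_rnDeriv [IsProbabilityMeasure ν] (hac : ν ≪ μ) :
    IsProbDensity μ fun x => (ν.rnDeriv μ x).toReal where
  measurable := (Measure.measurable_rnDeriv _ _).ennreal_toReal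
  nonneg _ := ENNReal.toReal_nonneg
  integral_eq_one := by rw [Measure.integral_toReal_rnDeriv hac, probReal_univ]

end RnDeriv

section Gibbs

variable {E : Type*} [MeasurableSpace E] {μ : Measure E} {f g : E → ℝ}

theorem negMulLog_le_neg_mul_log_add_sub {a b : ℝ} (ha : 0 ≤ a) (hb : 0 < b) :
    Real.negMulLog a ≤ -(a * Real.log b) + (b - a) := by
  rcases ha.eq_or_lt with rfl | ha
  · simpa using hb.le
  · have h := mul_le_mul_of_nonneg_left (Real.log_le_sub_one_of_pos (div_pos hb ha)) ha.le
    rw [Real.log_div hb.ne' ha.ne', mul_sub, mul_sub, mul_div_cancel₀ _ ha.ne'] at h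
    unfold Real.negMulLog
    linarith

theorem negMulLog_le_mul_add_exp_neg {a : ℝ} (ha : 0 ≤ a) (v : ℝ) :
    Real.negMulLog a ≤ v * a + Real.exp (-v) := by
  have h := negMulLog_le_neg_mul_log_add_sub ha (Real.exp_pos (-v))
  rw [Real.log_exp] at h
  linarith

theorem IsProbDensity.densityEntropy_le_neg_integral_mul_log (hf : IsProbDensity μ f)
    (hg : IsProbDensity μ g) (hg0 : ∀ x, 0 < g x)
    (hent : Integrable (fun x => Real.negMulLog (f x)) μ)
    (hlog : Integrable (fun x => f x * Real.log (g x)) μ) :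
    densityEntropy μ f ≤ -∫ x, f x * Real.log (g x) ∂μ := by
  have hsub : Integrable (fun x => g x - f x) μ := hg.integrable.sub hf.integrable
  calc densityEntropy μ f ≤ ∫ x, (-(f x * Real.log (g x)) + (g x - f x)) ∂μ :=
        integral_mono hent (hlog.neg.add hsub) fun x =>
          negMulLog_le_neg_mul_log_add_sub (hf.nonneg x) (hg0 x)
    _ = -∫ x, f x * Real.log (g x) ∂μ := by
        rw [integral_add hlog.fun_neg hsub, integral_neg, integral_sub hg.integrable hf.integrable,
          hf.integral_eq_one, hg.integral_eq_one, sub_self, add_zero]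

end Gibbs

/-! ### Admissible densities -/

/-- Lebesgue probability densities of finite entropy whose `V`-moment is at most `R`: the densities
of the laws competing in the entropy maximisation that defines the rate function. -/
structure IsAdmissible (V : ℝ → ℝ) (R : ℝ) (f : ℝ → ℝ) : Prop extends IsProbDensity volume f where
  integrable_mul : Integrable fun t => V t * f t
  integral_mul_le : ∫ t, V t * f t ≤ R
  integrable_negMulLog : Integrable fun t => Real.negMulLog (f t)

namespace IsAdmissible

variable {V w f : ℝ → ℝ} {R ε C : ℝ}

theorem integrable_weight_mul (hf : IsAdmissible V R f) (hw : Measurable w)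
    (hC : ∀ t, |w t| ≤ ε * V t + C) : Integrable fun t => w t * f t := by
  refine ((hf.integrable_mul.const_mul ε).add (hf.integrable.const_mul C)).mono'
    (hw.mul hf.measurable).aestronglyMeasurable (Eventually.of_forall fun t => ?_)
  rw [norm_mul, Real.norm_eq_abs, Real.norm_of_nonneg (hf.nonneg t)]
  have hmul := mul_le_mul_of_nonneg_right (hC t) (hf.nonneg t)
  rw [add_mul, mul_assoc] at hmul
  exact hmul

theorem integral_weight_mul_le (hf : IsAdmissible V R f) (hw : Measurable w) (hε : 0 ≤ ε)
    (hC : ∀ t, |w t| ≤ ε * V t + C) : ∫ t, w t * f t ≤ ε * R + C := by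
  have iV := hf.integrable_mul.const_mul ε
  have i1 := hf.integrable.const_mul C
  calc ∫ t, w t * f t ≤ ∫ t, (ε * (V t * f t) + C * f t) := by
        refine integral_mono (hf.integrable_weight_mul hw hC) (iV.add i1) fun t => ?_
        linarith [mul_le_mul_of_nonneg_right ((le_abs_self _).trans (hC t)) (hf.nonneg t)]
    _ = ε * (∫ t, V t * f t) + C := by
        rw [integral_add iV i1, integral_const_mul, integral_const_mul, hf.integral_eq_one, mul_one]
    _ ≤ ε * R + C := by gcongr; exact hf.integral_mul_le

end IsAdmissible

/-! ### The Gibbs density -/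

/-- The Gibbs density proportional to `exp (α V)`. -/
noncomputable def gibbsDensity (V : ℝ → ℝ) (α t : ℝ) : ℝ :=
  Real.exp (α * V t) / ∫ s, Real.exp (α * V s)

section GibbsDensity

variable {V f : ℝ → ℝ} {R α : ℝ}

theorem gibbsDensity_pos (hV : IsOrlicz V) (hα : α < 0) (t : ℝ) : 0 < gibbsDensity V α t :=
  div_pos (Real.exp_pos _) (integral_exp_pos (hV.integrable_exp_mul hα))

theorem isProbDensity_gibbsDensity (hV : IsOrlicz V) (hα : α < 0) :
    IsProbDensity volume (gibbsDensity V α) where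
  measurable := by
    have hc := hV.continuous
    unfold gibbsDensity
    fun_prop
  nonneg t := (gibbsDensity_pos hV hα t).le
  integral_eq_one := by
    unfold gibbsDensity
    rw [integral_div, div_self (integral_exp_pos (hV.integrable_exp_mul hα)).ne']

theorem mul_log_gibbsDensity (hV : IsOrlicz V) (hα : α < 0) (a t : ℝ) :
    a * Real.log (gibbsDensity V α t)
      = α * (V t * a) - Real.log (∫ s, Real.exp (α * V s)) * a := by
  have hZ := integral_exp_pos (hV.integrable_exp_mul hα)
  rw [gibbsDensity, Real.log_div (Real.exp_ne_zero _) hZ.ne', Real.log_exp]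
  ring

theorem integrable_mul_log_gibbsDensity (hV : IsOrlicz V) (hα : α < 0)
    (hf : IsProbDensity volume f) (hVf : Integrable fun t => V t * f t) :
    Integrable fun t => f t * Real.log (gibbsDensity V α t) := by
  simp only [mul_log_gibbsDensity hV hα]
  exact (hVf.const_mul α).sub (hf.integrable.const_mul _)

theorem integral_mul_log_gibbsDensity (hV : IsOrlicz V) (hα : α < 0)
    (hf : IsProbDensity volume f) (hVf : Integrable fun t => V t * f t) :
    ∫ t, f t * Real.log (gibbsDensity V α t)
      = α * (∫ t, V t * f t) - Real.log (∫ t, Real.exp (α * V t)) := by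
  simp only [mul_log_gibbsDensity hV hα]
  rw [integral_sub (hVf.const_mul α) (hf.integrable.const_mul _), integral_const_mul,
    integral_const_mul, hf.integral_eq_one, mul_one]

theorem IsAdmissible.densityEntropy_le_neg_gibbsDual (hV : IsOrlicz V) (hα : α < 0)
    (hf : IsAdmissible V R f) : densityEntropy volume f ≤ -gibbsDual V R α := by
  have hle := hf.toIsProbDensity.densityEntropy_le_neg_integral_mul_log
    (isProbDensity_gibbsDensity hV hα) (gibbsDensity_pos hV hα) hf.integrable_negMulLog
    (integrable_mul_log_gibbsDensity hV hα hf.toIsProbDensity hf.integrable_mul)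
  rw [integral_mul_log_gibbsDensity hV hα hf.toIsProbDensity hf.integrable_mul] at hle
  unfold gibbsDual
  linarith [mul_le_mul_of_nonpos_left hf.integral_mul_le hα.le]

theorem mul_gibbsDensity (V : ℝ → ℝ) (α t : ℝ) :
    V t * gibbsDensity V α t = V t * Real.exp (α * V t) / ∫ s, Real.exp (α * V s) :=
  (mul_div_assoc _ _ _).symm

theorem integrable_mul_gibbsDensity (hV : IsOrlicz V) (hα : α < 0) :
    Integrable fun t => V t * gibbsDensity V α t := by
  have h := integrable_pow_mul_exp_of_mem_interior_integrableExpSet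
    (mem_interior_integrableExpSet hV hα) 1
  simp only [pow_one] at h
  simp only [mul_gibbsDensity]
  exact h.div_const _

theorem integral_mul_gibbsDensity_of_isMaxOn (hV : IsOrlicz V) (hα : α < 0)
    (hmax : IsMaxOn (gibbsDual V R) (Set.Iio 0) α) : ∫ t, V t * gibbsDensity V α t = R := by
  have hderiv := (hmax.isLocalMax (Iio_mem_nhds hα)).hasDerivAt_eq_zero (hasDerivAt_gibbsDual hV hα)
  simp only [mul_gibbsDensity]
  rw [integral_div]
  linarith

theorem isAdmissible_gibbsDensity_of_isMaxOn (hV : IsOrlicz V) (hα : α < 0)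
    (hmax : IsMaxOn (gibbsDual V R) (Set.Iio 0) α) : IsAdmissible V R (gibbsDensity V α) where
  toIsProbDensity := isProbDensity_gibbsDensity hV hα
  integrable_mul := integrable_mul_gibbsDensity hV hα
  integral_mul_le := (integral_mul_gibbsDensity_of_isMaxOn hV hα hmax).le
  integrable_negMulLog := by
    simp only [Real.negMulLog, neg_mul]
    exact (integrable_mul_log_gibbsDensity hV hα (isProbDensity_gibbsDensity hV hα)
      (integrable_mul_gibbsDensity hV hα)).neg

theorem densityEntropy_gibbsDensity_of_isMaxOn (hV : IsOrlicz V) (hα : α < 0)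
    (hmax : IsMaxOn (gibbsDual V R) (Set.Iio 0) α) :
    densityEntropy volume (gibbsDensity V α) = -gibbsDual V R α := by
  simp only [densityEntropy, Real.negMulLog, neg_mul]
  rw [integral_neg, integral_mul_log_gibbsDensity hV hα (isProbDensity_gibbsDensity hV hα)
    (integrable_mul_gibbsDensity hV hα), integral_mul_gibbsDensity_of_isMaxOn hV hα hmax, gibbsDual]

end GibbsDensity

/-! ### Laws of finite entropy and admissible densities -/

section Law

variable {V f : ℝ → ℝ} {p R x : ℝ} {ν : ProbabilityMeasure ℝ}

theorem diffEntropy_eq_lintegral_sub_lintegral (hf : IsProbDensity volume f)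
    (hν : (ν : Measure ℝ) = volume.withDensity fun t => ENNReal.ofReal (f t)) :
    diffEntropy ν = ((∫⁻ t, ENNReal.ofReal (Real.negMulLog (f t)) : ℝ≥0∞) : EReal)
      - ((∫⁻ t, ENNReal.ofReal (-Real.negMulLog (f t)) : ℝ≥0∞) : EReal) := by
  have hac : (ν : Measure ℝ) ≪ volume := hν ▸ withDensity_absolutelyContinuous _ _
  have hrn : ∀ᵐ t ∂(ν : Measure ℝ), ((ν : Measure ℝ).rnDeriv volume t).toReal = f t := by
    refine hac.ae_le ?_
    rw [hν]
    filter_upwards [Measure.rnDeriv_withDensity volume hf.measurable.ennreal_ofReal] with t ht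
    rw [ht, ENNReal.toReal_ofReal (hf.nonneg t)]
  have hlog : ∀ s : ℝ, ∫⁻ t, ENNReal.ofReal
      (s * Real.log ((ν : Measure ℝ).rnDeriv volume t).toReal) ∂(ν : Measure ℝ)
        = ∫⁻ t, ENNReal.ofReal (-s * Real.negMulLog (f t)) := by
    intro s
    have hm : Measurable fun t => s * Real.log (f t) :=
      (Real.measurable_log.comp hf.measurable).const_mul s
    calc _ = ∫⁻ t, ENNReal.ofReal (s * Real.log (f t)) ∂(ν : Measure ℝ) :=
          lintegral_congr_ae (hrn.mono fun t ht => by simp only [ht])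
      _ = ∫⁻ t, ENNReal.ofReal (s * Real.log (f t) * f t) := by
          rw [hν, hf.lintegral_ofReal_withDensity hm]
      _ = _ := lintegral_congr fun t => by rw [Real.negMulLog]; ring_nf
  have hpos := hlog (-1)
  have hneg := hlog 1
  simp only [neg_mul, one_mul, neg_neg] at hpos hneg
  rw [diffEntropy, if_pos hac, hpos, hneg]

theorem diffEntropy_eq_densityEntropy (hf : IsProbDensity volume f)
    (hν : (ν : Measure ℝ) = volume.withDensity fun t => ENNReal.ofReal (f t))
    (hent : Integrable fun t => Real.negMulLog (f t)) :
    diffEntropy ν = (densityEntropy volume f : EReal) := by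
  rw [diffEntropy_eq_lintegral_sub_lintegral hf hν, densityEntropy,
    integral_eq_lintegral_pos_part_sub_lintegral_neg_part hent, EReal.coe_sub,
    EReal.coe_ennreal_toReal hent.lintegral_lt_top.ne,
    EReal.coe_ennreal_toReal hent.fun_neg.lintegral_lt_top.ne]

theorem integrable_negMulLog_of_diffEntropy_ne_bot (hV : IsOrlicz V) (hf : IsProbDensity volume f)
    (hν : (ν : Measure ℝ) = volume.withDensity fun t => ENNReal.ofReal (f t))
    (hVf : Integrable fun t => V t * f t) (hbot : diffEntropy ν ≠ ⊥) :
    Integrable fun t => Real.negMulLog (f t) := by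
  rw [diffEntropy_eq_lintegral_sub_lintegral hf hν] at hbot
  refine integrable_of_lintegral_ofReal_ne_top hf.measurable_negMulLog.aestronglyMeasurable ?_ ?_
  · have hdom := hVf.add (hV.integrable_exp_mul neg_one_lt_zero)
    refine ne_top_of_le_ne_top hdom.lintegral_lt_top.ne
      (lintegral_mono fun t => ENNReal.ofReal_le_ofReal ?_)
    simpa using negMulLog_le_mul_add_exp_neg (hf.nonneg t) (V t)
  · intro htop
    rw [htop, EReal.coe_ennreal_top] at hbot
    exact hbot (EReal.sub_top _)

theorem mem_entropyConstraint_iff (hV : IsOrlicz V) (hp : 0 < p) (hR : 0 ≤ R) (hx : 0 ≤ x)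
    (hf : IsProbDensity volume f)
    (hν : (ν : Measure ℝ) = volume.withDensity fun t => ENNReal.ofReal (f t)) :
    ν ∈ entropyConstraint V p R x ↔
      (Integrable (fun t => |t| ^ p * f t) ∧ ∫ t, |t| ^ p * f t = x ^ p) ∧
        Integrable (fun t => V t * f t) ∧ ∫ t, V t * f t ≤ R := by
  have hVm := hV.continuous.measurable
  have hpm : Measurable fun t : ℝ => |t| ^ p := by fun_prop
  have hroot : ∀ a b : ℝ≥0∞, a ^ p⁻¹ = b ↔ a = b ^ p := fun a b =>
    ⟨fun h => by rw [← h, ENNReal.rpow_inv_rpow hp.ne'],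
      fun h => by rw [h, ENNReal.rpow_rpow_inv hp.ne']⟩
  rw [entropyConstraint, Set.mem_ofPred_eq, moment_of, moment_of, hν,
    hf.lintegral_ofReal_withDensity hpm, hf.lintegral_ofReal_withDensity hVm, one_div,
    hroot, ENNReal.ofReal_rpow_of_nonneg hx hp.le,
    lintegral_ofReal_eq_ofReal_iff (hpm.fun_mul hf.measurable).aestronglyMeasurable
      (ae_of_all _ fun t => mul_nonneg (by positivity) (hf.nonneg t)) (by positivity),
    lintegral_ofReal_le_ofReal_iff (hVm.fun_mul hf.measurable).aestronglyMeasurable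
      (ae_of_all _ fun t => mul_nonneg (hV.nonneg t) (hf.nonneg t)) hR]

theorem exists_isAdmissible_of_mem_entropyConstraint (hV : IsOrlicz V) (hp : 0 < p) (hR : 0 ≤ R)
    (hx : 0 ≤ x) (hν : ν ∈ entropyConstraint V p R x) (hbot : diffEntropy ν ≠ ⊥) :
    ∃ f, IsAdmissible V R f ∧ ∫ t, |t| ^ p * f t = x ^ p ∧
      diffEntropy ν = (densityEntropy volume f : EReal) := by
  have hac : (ν : Measure ℝ) ≪ volume := by
    by_contra h
    exact hbot (if_neg h)
  have hf := isProbDensity_toReal_rnDeriv hac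
  have hνf := (withDensity_ofReal_toReal_rnDeriv hac).symm
  obtain ⟨⟨-, hmom⟩, hVf, hVR⟩ := (mem_entropyConstraint_iff hV hp hR hx hf hνf).1 hν
  have hent := integrable_negMulLog_of_diffEntropy_ne_bot hV hf hνf hVf hbot
  exact ⟨_, ⟨hf, hVf, hVR, hent⟩, hmom, diffEntropy_eq_densityEntropy hf hνf hent⟩

theorem IsAdmissible.exists_mem_entropyConstraint (hV : IsOrlicz V) (hp : 0 < p) (hR : 0 ≤ R)
    (hx : 0 ≤ x) (hf : IsAdmissible V R f) (hint : Integrable fun t => |t| ^ p * f t)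
    (hmom : ∫ t, |t| ^ p * f t = x ^ p) :
    ∃ ν ∈ entropyConstraint V p R x, diffEntropy ν = (densityEntropy volume f : EReal) := by
  have hprob := hf.isProbabilityMeasure_withDensity
  exact ⟨⟨_, hprob⟩, (mem_entropyConstraint_iff hV hp hR hx hf.toIsProbDensity rfl).2
    ⟨⟨hint, hmom⟩, hf.integrable_mul, hf.integral_mul_le⟩,
    diffEntropy_eq_densityEntropy hf.toIsProbDensity rfl hf.integrable_negMulLog⟩

end Law

/-! ### Hellinger distance and gain of entropy at midpoints -/

section Hellinger

variable {E : Type*} [MeasurableSpace E] {μ : Measure E} {f g : E → ℝ}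

theorem negMulLog_le_neg_mul_log_add_two_mul_sqrt {a m : ℝ} (ha : 0 ≤ a) (hm : 0 < m) :
    Real.negMulLog a ≤ -(a * Real.log m) + 2 * (√m * √a - a) := by
  have h := mul_le_mul_of_nonneg_left
    (negMulLog_le_neg_mul_log_add_sub (Real.sqrt_nonneg a) (Real.sqrt_pos.2 hm))
    (Real.sqrt_nonneg a)
  have hsq : √a * √a = a := Real.mul_self_sqrt ha
  rw [Real.negMulLog, Real.log_sqrt ha, Real.log_sqrt hm.le] at h
  have hlhs : √a * (-√a * (Real.log a / 2)) = Real.negMulLog a / 2 := by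
    rw [Real.negMulLog]
    linear_combination -(Real.log a / 2) * hsq
  have hrhs : √a * (-(√a * (Real.log m / 2)) + (√m - √a))
      = -(a * Real.log m) / 2 + (√m * √a - a) := by
    linear_combination (-(Real.log m / 2) - 1) * hsq
  rw [hlhs, hrhs] at h
  linarith

theorem half_negMulLog_add_sq_sqrt_sub_sqrt_le {a b : ℝ} (ha : 0 ≤ a) (hb : 0 ≤ b) :
    (Real.negMulLog a + Real.negMulLog b) / 2 + (√a - √b) ^ 2 / 4
      ≤ Real.negMulLog ((a + b) / 2) := by
  set m := (a + b) / 2 with hm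
  rcases (show 0 ≤ m by positivity).eq_or_lt with h0 | h0
  · obtain rfl : a = 0 := by linarith
    obtain rfl : b = 0 := by linarith
    simp [← h0]
  have hma := negMulLog_le_neg_mul_log_add_two_mul_sqrt ha h0
  have hmb := negMulLog_le_neg_mul_log_add_two_mul_sqrt hb h0
  have hlog : a * Real.log m + b * Real.log m = 2 * (m * Real.log m) := by rw [hm]; ring
  rw [show Real.negMulLog m = -(m * Real.log m) by rw [Real.negMulLog]; ring]
  nlinarith [sq_nonneg (√a + √b - 2 * √m), Real.sq_sqrt ha, Real.sq_sqrt hb, Real.sq_sqrt h0.le]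

theorem IsProbDensity.memLp_sqrt (hf : IsProbDensity μ f) : MemLp (fun x => √(f x)) 2 μ := by
  rw [memLp_two_iff_integrable_sq hf.measurable.sqrt.aestronglyMeasurable]
  simpa only [Real.sq_sqrt (hf.nonneg _)] using hf.integrable

theorem IsProbDensity.midpoint (hf : IsProbDensity μ f) (hg : IsProbDensity μ g) :
    IsProbDensity μ fun x => (f x + g x) / 2 where
  measurable := (hf.measurable.add hg.measurable).div_const 2
  nonneg x := by linarith [hf.nonneg x, hg.nonneg x]
  integral_eq_one := by
    rw [integral_div, integral_add hf.integrable hg.integrable, hf.integral_eq_one,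
      hg.integral_eq_one]
    norm_num

theorem integrable_half_negMulLog_add_sq_sqrt_sub_sqrt (hf : IsProbDensity μ f)
    (hg : IsProbDensity μ g) (hfe : Integrable (fun x => Real.negMulLog (f x)) μ)
    (hge : Integrable (fun x => Real.negMulLog (g x)) μ) :
    Integrable (fun x => (Real.negMulLog (f x) + Real.negMulLog (g x)) / 2
      + (√(f x) - √(g x)) ^ 2 / 4) μ :=
  ((hfe.add hge).div_const 2).add ((hf.memLp_sqrt.sub hg.memLp_sqrt).integrable_sq.div_const 4)

theorem half_densityEntropy_add_hellinger_le (hf : IsProbDensity μ f)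
    (hg : IsProbDensity μ g) (hfe : Integrable (fun x => Real.negMulLog (f x)) μ)
    (hge : Integrable (fun x => Real.negMulLog (g x)) μ)
    (hme : Integrable (fun x => Real.negMulLog ((f x + g x) / 2)) μ) :
    (densityEntropy μ f + densityEntropy μ g) / 2 + (∫ x, (√(f x) - √(g x)) ^ 2 ∂μ) / 4
      ≤ densityEntropy μ fun x => (f x + g x) / 2 := by
  have hsq : Integrable (fun x => (√(f x) - √(g x)) ^ 2 / 4) μ :=
    (hf.memLp_sqrt.sub hg.memLp_sqrt).integrable_sq.div_const 4
  calc _ = ∫ x, ((Real.negMulLog (f x) + Real.negMulLog (g x)) / 2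
          + (√(f x) - √(g x)) ^ 2 / 4) ∂μ := by
        rw [integral_add ((hfe.fun_add hge).div_const 2) hsq, integral_div, integral_div,
          integral_add hfe hge, densityEntropy, densityEntropy]
    _ ≤ _ := integral_mono (integrable_half_negMulLog_add_sq_sqrt_sub_sqrt hf hg hfe hge) hme
        fun x => half_negMulLog_add_sq_sqrt_sub_sqrt_le (hf.nonneg x) (hg.nonneg x)

theorem sq_norm_toLp_two (hf : MemLp f 2 μ) : ‖hf.toLp‖ ^ 2 = ∫ x, f x ^ 2 ∂μ := by
  rw [← real_inner_self_eq_norm_sq, L2.inner_def]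
  refine integral_congr_ae ?_
  filter_upwards [hf.coeFn_toLp] with x hx
  rw [hx, real_inner_self_eq_norm_sq, Real.norm_eq_abs, sq_abs]

theorem exists_subseq_tendsto_ae_of_hellinger_tendsto_zero {fs : ℕ → E → ℝ}
    (hfs : ∀ k, IsProbDensity μ (fs k))
    (hdist : Tendsto (fun jk : ℕ × ℕ => ∫ x, (√(fs jk.1 x) - √(fs jk.2 x)) ^ 2 ∂μ) atTop (𝓝 0)) :
    ∃ f, IsProbDensity μ f ∧ ∃ ns : ℕ → ℕ, StrictMono ns ∧
      ∀ᵐ x ∂μ, Tendsto (fun k => fs (ns k) x) atTop (𝓝 (f x)) := by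
  set u : ℕ → Lp ℝ 2 μ := fun k => (hfs k).memLp_sqrt.toLp
  have hu : CauchySeq u := by
    refine cauchySeq_iff_tendsto_dist_atTop_0.2 ?_
    have hsqrt := hdist.sqrt
    rw [Real.sqrt_zero] at hsqrt
    refine hsqrt.congr fun jk => ?_
    rw [dist_eq_norm, ← Real.sqrt_sq (norm_nonneg _), ← MemLp.toLp_sub, sq_norm_toLp_two]
    rfl
  obtain ⟨ψ, hψ⟩ := cauchySeq_tendsto_of_complete hu
  obtain ⟨ns, hns, hae⟩ := (tendstoInMeasure_of_tendsto_Lp hψ).exists_seq_tendsto_ae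
  have hnorm : ∫ x, ψ x ^ 2 ∂μ = 1 := by
    have hu1 : ∀ k, ‖u k‖ ^ 2 = 1 := fun k => by
      simp only [u, sq_norm_toLp_two, Real.sq_sqrt ((hfs k).nonneg _), (hfs k).integral_eq_one]
    rw [← sq_norm_toLp_two (Lp.memLp ψ), Lp.toLp_coeFn]
    exact tendsto_nhds_unique (hψ.norm.pow 2) (by simp only [hu1, tendsto_const_nhds])
  refine ⟨fun x => ψ x ^ 2, ⟨(Lp.stronglyMeasurable ψ).measurable.pow_const 2,
    fun x => sq_nonneg _, hnorm⟩, ns, hns, ?_⟩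
  have hcoe : ∀ᵐ x ∂μ, ∀ k, u k x = √(fs k x) :=
    ae_all_iff.2 fun k => (hfs k).memLp_sqrt.coeFn_toLp
  filter_upwards [hae, hcoe] with x hx hux
  refine (hx.pow 2).congr fun k => ?_
  rw [hux, Real.sq_sqrt ((hfs (ns k)).nonneg x)]

end Hellinger

theorem integrable_and_integral_le_of_tendsto_ae {E : Type*} [MeasurableSpace E] {μ : Measure E}
    {F : ℕ → E → ℝ} {G : E → ℝ} {c : ℕ → ℝ} {d : ℝ}
    (hG : AEStronglyMeasurable G μ) (hF : ∀ k, Integrable (F k) μ) (h0 : ∀ k, 0 ≤ᵐ[μ] F k)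
    (hlim : ∀ᵐ x ∂μ, Tendsto (fun k => F k x) atTop (𝓝 (G x)))
    (hc : ∀ k, ∫ x, F k x ∂μ ≤ c k) (hcd : Tendsto c atTop (𝓝 d)) :
    Integrable G μ ∧ ∫ x, G x ∂μ ≤ d := by
  have hG0 : 0 ≤ᵐ[μ] G := by
    filter_upwards [hlim, ae_all_iff.2 h0] with x hx hFx
    exact ge_of_tendsto' hx hFx
  have hd : 0 ≤ d := ge_of_tendsto' hcd fun k => (integral_nonneg_of_ae (h0 k)).trans (hc k)
  refine (lintegral_ofReal_le_ofReal_iff hG hG0 hd).1 ?_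
  calc ∫⁻ x, ENNReal.ofReal (G x) ∂μ
      = ∫⁻ x, liminf (fun k => ENNReal.ofReal (F k x)) atTop ∂μ := by
        refine lintegral_congr_ae (hlim.mono fun x hx => ?_)
        exact ((ENNReal.continuous_ofReal.tendsto _).comp hx).liminf_eq.symm
    _ ≤ liminf (fun k => ∫⁻ x, ENNReal.ofReal (F k x) ∂μ) atTop :=
        lintegral_liminf_le' fun k => (hF k).1.aemeasurable.ennreal_ofReal
    _ ≤ liminf (fun k => ENNReal.ofReal (c k)) atTop := by
        refine liminf_le_liminf (Eventually.of_forall fun k => ?_)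
        rw [← ofReal_integral_eq_lintegral_ofReal (hF k) (h0 k)]
        exact ENNReal.ofReal_le_ofReal (hc k)
    _ = ENNReal.ofReal d := ((ENNReal.continuous_ofReal.tendsto _).comp hcd).liminf_eq

/-! ### Limits of admissible densities -/

theorem le_of_forall_pos_le_add_mul {a b c : ℝ} (h : ∀ ε > 0, a ≤ b + ε * c) : a ≤ b := by
  have hlim : Tendsto (fun ε : ℝ => b + ε * c) (𝓝[>] 0) (𝓝 b) := by
    have hcont : Continuous fun ε : ℝ => b + ε * c := by fun_prop
    simpa using (hcont.tendsto 0).mono_left nhdsWithin_le_nhds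
  exact ge_of_tendsto hlim (eventually_mem_nhdsWithin.mono h)

section Limit

variable {V w f g : ℝ → ℝ} {R s y : ℝ} {fs : ℕ → ℝ → ℝ}

theorem IsAdmissible.midpoint (hV : IsOrlicz V) (hf : IsAdmissible V R f)
    (hg : IsAdmissible V R g) : IsAdmissible V R fun t => (f t + g t) / 2 := by
  have hm := hf.toIsProbDensity.midpoint hg.toIsProbDensity
  have heq : ∀ t, V t * ((f t + g t) / 2) = (V t * f t + V t * g t) / 2 := fun t => by ring
  have iV : Integrable fun t => V t * ((f t + g t) / 2) := by
    simp only [heq]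
    exact (hf.integrable_mul.add hg.integrable_mul).div_const 2
  refine ⟨hm, iV, ?_, ?_⟩
  · simp only [heq]
    rw [integral_div, integral_add hf.integrable_mul hg.integrable_mul]
    linarith [hf.integral_mul_le, hg.integral_mul_le]
  · refine integrable_of_le_of_le hm.measurable_negMulLog.aestronglyMeasurable
      (ae_of_all _ fun t => half_negMulLog_add_sq_sqrt_sub_sqrt_le (hf.nonneg t) (hg.nonneg t))
      (ae_of_all _ fun t => negMulLog_le_mul_add_exp_neg (hm.nonneg t) (V t))
      (integrable_half_negMulLog_add_sq_sqrt_sub_sqrt hf.toIsProbDensity hg.toIsProbDensity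
        hf.integrable_negMulLog hg.integrable_negMulLog)
      (iV.add ?_)
    simpa using hV.integrable_exp_mul neg_one_lt_zero

theorem integral_mul_midpoint (hf : Integrable fun t => w t * f t)
    (hg : Integrable fun t => w t * g t) :
    ∫ t, w t * ((f t + g t) / 2) = ((∫ t, w t * f t) + ∫ t, w t * g t) / 2 := by
  rw [← integral_add hf hg, ← integral_div]
  exact integral_congr_ae (ae_of_all _ fun t => by ring)

theorem integrable_and_integral_mul_le_of_tendsto_ae (hV : IsOrlicz V)
    (hfs : ∀ k, IsAdmissible V R (fs k)) (hf : IsProbDensity volume f)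
    (hlim : ∀ᵐ t, Tendsto (fun k => fs k t) atTop (𝓝 (f t))) :
    Integrable (fun t => V t * f t) ∧ ∫ t, V t * f t ≤ R :=
  integrable_and_integral_le_of_tendsto_ae
    (hV.continuous.measurable.fun_mul hf.measurable).aestronglyMeasurable
    (fun k => (hfs k).integrable_mul)
    (fun k => ae_of_all _ fun t => mul_nonneg (hV.nonneg t) ((hfs k).nonneg t))
    (hlim.mono fun _ ht => ht.const_mul _) (fun k => (hfs k).integral_mul_le) tendsto_const_nhds

theorem integral_weight_mul_le_of_tendsto_ae (hV : IsOrlicz V) (hwc : Continuous w)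
    (hw : w =o[cocompact ℝ] V) (hfs : ∀ k, IsAdmissible V R (fs k)) (hf : IsAdmissible V R f)
    (hlim : ∀ᵐ t, Tendsto (fun k => fs k t) atTop (𝓝 (f t)))
    (hmom : Tendsto (fun k => ∫ t, w t * fs k t) atTop (𝓝 y)) : ∫ t, w t * f t ≤ y := by
  refine le_of_forall_pos_le_add_mul (c := R) fun ε hε => ?_
  obtain ⟨C, hC⟩ := hV.exists_abs_le_mul_add hwc hw hε
  have hsum : ∀ {g : ℝ → ℝ}, IsAdmissible V R g →
      Integrable (fun t => w t * g t + ε * (V t * g t) + C * g t) ∧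
        ∫ t, (w t * g t + ε * (V t * g t) + C * g t)
          = (∫ t, w t * g t) + ε * (∫ t, V t * g t) + C := by
    intro g hg
    have iw := hg.integrable_weight_mul hwc.measurable hC
    have iV := hg.integrable_mul.const_mul ε
    have i1 := hg.integrable.const_mul C
    refine ⟨(iw.add iV).add i1, ?_⟩
    rw [integral_add (iw.fun_add iV) i1, integral_add iw iV, integral_const_mul, integral_const_mul,
      hg.integral_eq_one, mul_one]
  have hFatou := (integrable_and_integral_le_of_tendsto_ae
    (c := fun k => (∫ t, w t * fs k t) + ε * R + C) (hsum hf).1.aestronglyMeasurable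
    (fun k => (hsum (hfs k)).1)
    (fun k => ae_of_all _ fun t => by
      have h := mul_nonneg (by linarith [neg_abs_le (w t), hC t] : 0 ≤ w t + ε * V t + C)
        ((hfs k).nonneg t)
      rw [add_mul, add_mul, mul_assoc] at h
      exact h)
    (hlim.mono fun _ ht => ((ht.const_mul _).add ((ht.const_mul _).const_mul _)).add
      (ht.const_mul _))
    (fun k => by
      rw [(hsum (hfs k)).2]
      gcongr
      exact (hfs k).integral_mul_le)
    ((hmom.add_const _).add_const _)).2
  rw [(hsum hf).2] at hFatou
  have hpos : 0 ≤ ε * ∫ t, V t * f t :=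
    mul_nonneg hε.le (integral_nonneg fun t => mul_nonneg (hV.nonneg t) (hf.nonneg t))
  linarith

theorem integral_weight_mul_eq_of_tendsto_ae (hV : IsOrlicz V) (hwc : Continuous w)
    (hw : w =o[cocompact ℝ] V) (hfs : ∀ k, IsAdmissible V R (fs k)) (hf : IsAdmissible V R f)
    (hlim : ∀ᵐ t, Tendsto (fun k => fs k t) atTop (𝓝 (f t)))
    (hmom : Tendsto (fun k => ∫ t, w t * fs k t) atTop (𝓝 y)) : ∫ t, w t * f t = y := by
  refine le_antisymm (integral_weight_mul_le_of_tendsto_ae hV hwc hw hfs hf hlim hmom) ?_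
  have h := integral_weight_mul_le_of_tendsto_ae hV hwc.neg hw.neg_left hfs hf hlim (y := -y)
    (by simpa only [Pi.neg_apply, neg_mul, integral_neg] using hmom.neg)
  simp only [Pi.neg_apply, neg_mul, integral_neg] at h
  linarith

theorem integrable_negMulLog_and_le_add_of_tendsto_ae (hV : IsOrlicz V)
    (hfs : ∀ k, IsAdmissible V R (fs k)) (hf : IsProbDensity volume f)
    (hlim : ∀ᵐ t, Tendsto (fun k => fs k t) atTop (𝓝 (f t)))
    (hent : Tendsto (fun k => densityEntropy volume (fs k)) atTop (𝓝 s)) {ε : ℝ} (hε : 0 < ε) :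
    Integrable (fun t => Real.negMulLog (f t)) ∧ s ≤ densityEntropy volume f + ε * R := by
  obtain ⟨iV, -⟩ := integrable_and_integral_mul_le_of_tendsto_ae hV hfs hf hlim
  have iE := hV.integrable_exp_mul (neg_lt_zero.2 hε)
  set Z := ∫ t, Real.exp (-ε * V t)
  have isum : ∀ {g : ℝ → ℝ}, Integrable (fun t => V t * g t) →
      Integrable fun t => ε * (V t * g t) + Real.exp (-ε * V t) := fun h => (h.const_mul ε).add iE
  have hint : ∀ {g : ℝ → ℝ}, Integrable (fun t => V t * g t) →
      Integrable (fun t => Real.negMulLog (g t)) →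
      ∫ t, (ε * (V t * g t) + Real.exp (-ε * V t) - Real.negMulLog (g t))
        = ε * (∫ t, V t * g t) + Z - densityEntropy volume g := fun hVg hg => by
    rw [integral_sub (isum hVg) hg, integral_add (hVg.const_mul ε) iE, integral_const_mul,
      densityEntropy]
  obtain ⟨iG, hG⟩ := integrable_and_integral_le_of_tendsto_ae
    (F := fun k t => ε * (V t * fs k t) + Real.exp (-ε * V t) - Real.negMulLog (fs k t))
    (c := fun k => ε * R + Z - densityEntropy volume (fs k))
    ((isum iV).aestronglyMeasurable.sub hf.measurable_negMulLog.aestronglyMeasurable)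
    (fun k => (isum (hfs k).integrable_mul).sub (hfs k).integrable_negMulLog)
    (fun k => ae_of_all _ fun t => by
      have h := negMulLog_le_mul_add_exp_neg ((hfs k).nonneg t) (ε * V t)
      rw [mul_assoc, ← neg_mul] at h
      exact sub_nonneg.2 h)
    (hlim.mono fun t ht => (((ht.const_mul _).const_mul _).add_const _).sub
      ((Real.continuous_negMulLog.tendsto _).comp ht))
    (fun k => by
      rw [hint (hfs k).integrable_mul (hfs k).integrable_negMulLog]
      gcongr
      exact (hfs k).integral_mul_le)
    (hent.const_sub _)
  have ient : Integrable fun t => Real.negMulLog (f t) := by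
    simpa using (isum iV).sub iG
  have hG' := (hint iV ient).symm.le.trans hG
  have hpos : 0 ≤ ε * ∫ t, V t * f t :=
    mul_nonneg hε.le (integral_nonneg fun t => mul_nonneg (hV.nonneg t) (hf.nonneg t))
  exact ⟨ient, by linarith⟩

theorem isAdmissible_and_le_of_tendsto_ae (hV : IsOrlicz V)
    (hfs : ∀ k, IsAdmissible V R (fs k)) (hf : IsProbDensity volume f)
    (hlim : ∀ᵐ t, Tendsto (fun k => fs k t) atTop (𝓝 (f t)))
    (hent : Tendsto (fun k => densityEntropy volume (fs k)) atTop (𝓝 s)) :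
    IsAdmissible V R f ∧ s ≤ densityEntropy volume f := by
  obtain ⟨iV, hVR⟩ := integrable_and_integral_mul_le_of_tendsto_ae hV hfs hf hlim
  have h := fun {ε : ℝ} (hε : 0 < ε) =>
    integrable_negMulLog_and_le_add_of_tendsto_ae hV hfs hf hlim hent hε
  exact ⟨⟨hf, iV, hVR, (h one_pos).1⟩, le_of_forall_pos_le_add_mul fun ε hε => (h hε).2⟩

end Limit

/-! ### The entropy hypograph is closed -/

/-- The pairs `(y, s)` with `s ≤ h(f)` for some admissible density `f` with `∫ w f = y`, i.e. the
hypograph of the maximal entropy as a function of the moment `y`. The weight `w` stands for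
`|t| ^ p`. -/
def entropyHypograph (V : ℝ → ℝ) (R : ℝ) (w : ℝ → ℝ) : Set (ℝ × ℝ) :=
  {z | ∃ f, IsAdmissible V R f ∧ ∫ t, w t * f t = z.1 ∧ z.2 ≤ densityEntropy volume f}

theorem tendsto_fst_atTop_atTop {α β : Type*} [Preorder α] [Preorder β] :
    Tendsto (Prod.fst : α × β → α) atTop atTop := by
  rw [← prod_atTop_atTop_eq]
  exact tendsto_fst

theorem tendsto_snd_atTop_atTop {α β : Type*} [Preorder α] [Preorder β] :
    Tendsto (Prod.snd : α × β → β) atTop atTop := by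
  rw [← prod_atTop_atTop_eq]
  exact tendsto_snd

section Hypograph

variable {V w : ℝ → ℝ} {R s y : ℝ} {fs : ℕ → ℝ → ℝ}

theorem tendsto_hellinger_of_tendsto_densityEntropy (hV : IsOrlicz V)
    (hfs : ∀ k, IsAdmissible V R (fs k))
    (hent : Tendsto (fun k => densityEntropy volume (fs k)) atTop (𝓝 s))
    (hmid : ∀ e > s, ∀ᶠ jk : ℕ × ℕ in atTop,
      densityEntropy volume (fun t => (fs jk.1 t + fs jk.2 t) / 2) < e) :
    Tendsto (fun jk : ℕ × ℕ => ∫ t, (√(fs jk.1 t) - √(fs jk.2 t)) ^ 2) atTop (𝓝 0) := by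
  refine tendsto_order.2 ⟨fun a ha => Eventually.of_forall fun jk =>
    ha.trans_le (integral_nonneg fun t => sq_nonneg _), fun δ hδ => ?_⟩
  have hlow : ∀ᶠ k in atTop, s - δ / 8 < densityEntropy volume (fs k) :=
    hent.eventually_const_lt (by linarith)
  filter_upwards [hmid (s + δ / 8) (by linarith), tendsto_fst_atTop_atTop.eventually hlow,
    tendsto_snd_atTop_atTop.eventually hlow] with jk hjk hj hk
  have hgain := half_densityEntropy_add_hellinger_le (hfs jk.1).toIsProbDensity
    (hfs jk.2).toIsProbDensity (hfs jk.1).integrable_negMulLog (hfs jk.2).integrable_negMulLog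
    ((hfs jk.1).midpoint hV (hfs jk.2)).integrable_negMulLog
  linarith

theorem mem_entropyHypograph_of_tendsto (hV : IsOrlicz V) (hwc : Continuous w)
    (hw : w =o[cocompact ℝ] V) (hfs : ∀ k, IsAdmissible V R (fs k))
    (hmom : Tendsto (fun k => ∫ t, w t * fs k t) atTop (𝓝 y))
    (hent : Tendsto (fun k => densityEntropy volume (fs k)) atTop (𝓝 s))
    (hsup : ∀ e > s, ∀ᶠ y' in 𝓝 y, (y', e) ∉ entropyHypograph V R w) :
    (y, s) ∈ entropyHypograph V R w := by
  obtain ⟨C, hC⟩ := hV.exists_abs_le_mul_add hwc hw one_pos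
  have iw := fun k => (hfs k).integrable_weight_mul hwc.measurable hC
  have hmid : Tendsto (fun jk : ℕ × ℕ => ∫ t, w t * ((fs jk.1 t + fs jk.2 t) / 2)) atTop (𝓝 y) := by
    simp only [integral_mul_midpoint (iw _) (iw _)]
    simpa using ((hmom.comp tendsto_fst_atTop_atTop).add
      (hmom.comp tendsto_snd_atTop_atTop)).div_const 2
  obtain ⟨f, hf, ns, hns, hlim⟩ := exists_subseq_tendsto_ae_of_hellinger_tendsto_zero
    (fun k => (hfs k).toIsProbDensity) (tendsto_hellinger_of_tendsto_densityEntropy hV hfs hent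
      fun e he => (hmid.eventually (hsup e he)).mono fun jk hjk => lt_of_not_ge fun hle =>
        hjk ⟨_, (hfs jk.1).midpoint hV (hfs jk.2), rfl, hle⟩)
  obtain ⟨hfa, hs⟩ := isAdmissible_and_le_of_tendsto_ae hV (fun k => hfs (ns k)) hf hlim
    (hent.comp hns.tendsto_atTop)
  exact ⟨f, hfa, integral_weight_mul_eq_of_tendsto_ae hV hwc hw (fun k => hfs (ns k)) hfa hlim
    (hmom.comp hns.tendsto_atTop), hs⟩

theorem le_neg_gibbsDual_of_mem_closure_entropyHypograph (hV : IsOrlicz V) {z : ℝ × ℝ}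
    (hz : z ∈ closure (entropyHypograph V R w)) : z.2 ≤ -gibbsDual V R (-1) := by
  refine closure_minimal ?_ (isClosed_le continuous_snd continuous_const) hz
  rintro z ⟨f, hf, -, hz2⟩
  exact hz2.trans (hf.densityEntropy_le_neg_gibbsDual hV neg_one_lt_zero)

theorem isClosed_entropyHypograph (hV : IsOrlicz V) (hwc : Continuous w)
    (hw : w =o[cocompact ℝ] V) : IsClosed (entropyHypograph V R w) := by
  refine isClosed_of_closure_subset fun ⟨y, c⟩ hyc => ?_
  set S := {e | (y, e) ∈ closure (entropyHypograph V R w)}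
  have hSb : BddAbove S := ⟨_, fun e => le_neg_gibbsDual_of_mem_closure_entropyHypograph hV⟩
  have hSc : IsClosed S := isClosed_closure.preimage (Continuous.prodMk_right y)
  have htop : (y, sSup S) ∈ closure (entropyHypograph V R w) := hSc.csSup_mem ⟨c, hyc⟩ hSb
  have hsup : ∀ e > sSup S, ∀ᶠ y' in 𝓝 y, (y', e) ∉ entropyHypograph V R w := fun e he =>
    have hye : (y, e) ∉ closure (entropyHypograph V R w) := fun h => he.not_ge (le_csSup hSb h)
    ((Continuous.prodMk_left e).tendsto y).eventually
      (eventually_of_mem (isClosed_closure.isOpen_compl.mem_nhds hye)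
        fun _ => notMem_of_notMem_closure)
  obtain ⟨zs, hzs, hlim⟩ := mem_closure_iff_seq_limit.1 htop
  choose fs hfs hmom hle using hzs
  have hlim1 : Tendsto (fun k => ∫ t, w t * fs k t) atTop (𝓝 y) := by
    simp only [hmom]
    exact (continuous_fst.tendsto _).comp hlim
  have hlim2 : Tendsto (fun k => densityEntropy volume (fs k)) atTop (𝓝 (sSup S)) := by
    refine tendsto_order.2 ⟨fun a ha => ?_, fun e he => ?_⟩
    · exact (((continuous_snd.tendsto _).comp hlim).eventually_const_lt ha).mono
        fun k hk => hk.trans_le (hle k)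
    · exact (hlim1.eventually (hsup e he)).mono
        fun k hk => lt_of_not_ge fun h => hk ⟨_, hfs k, rfl, h⟩
  obtain ⟨f, hf, hfy, hSf⟩ :=
    mem_entropyHypograph_of_tendsto hV hwc hw hfs hlim1 hlim2 hsup
  exact ⟨f, hf, hfy, (le_csSup hSb hyc).trans hSf⟩

end Hypograph

/-! ### Dilations -/

/-- The density of `l X` for a real random variable `X` with density `f` and `l > 0`. -/
noncomputable def dilatedDensity (l : ℝ) (f : ℝ → ℝ) (t : ℝ) : ℝ :=
  l⁻¹ * f (l⁻¹ * t)

section Dilation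

variable {V w f : ℝ → ℝ} {R l : ℝ}

theorem integral_inv_mul_comp_inv_mul (hl : 0 < l) (g : ℝ → ℝ) :
    ∫ t, l⁻¹ * g (l⁻¹ * t) = ∫ t, g t := by
  rw [integral_const_mul, Measure.integral_comp_mul_left, inv_inv, abs_of_pos hl, smul_eq_mul,
    inv_mul_cancel_left₀ hl.ne']

theorem integrable_inv_mul_comp_inv_mul {g : ℝ → ℝ} (hl : 0 < l)
    (hg : Integrable g) : Integrable fun t => l⁻¹ * g (l⁻¹ * t) :=
  (hg.comp_mul_left' (inv_ne_zero hl.ne')).const_mul _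

theorem mul_dilatedDensity (hl : 0 < l) (t : ℝ) :
    w t * dilatedDensity l f t = l⁻¹ * (w (l * (l⁻¹ * t)) * f (l⁻¹ * t)) := by
  rw [dilatedDensity, mul_inv_cancel_left₀ hl.ne']
  ring

theorem integral_mul_dilatedDensity (hl : 0 < l) :
    ∫ t, w t * dilatedDensity l f t = ∫ t, w (l * t) * f t := by
  simp only [mul_dilatedDensity hl]
  exact integral_inv_mul_comp_inv_mul hl fun t => w (l * t) * f t

theorem integrable_mul_dilatedDensity (hl : 0 < l) (h : Integrable fun t => w (l * t) * f t) :
    Integrable fun t => w t * dilatedDensity l f t := by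
  simp only [mul_dilatedDensity hl]
  exact integrable_inv_mul_comp_inv_mul hl h

theorem negMulLog_dilatedDensity (l : ℝ) (f : ℝ → ℝ) (t : ℝ) :
    Real.negMulLog (dilatedDensity l f t)
      = l⁻¹ * (Real.negMulLog (f (l⁻¹ * t)) + Real.log l * f (l⁻¹ * t)) := by
  rw [dilatedDensity, Real.negMulLog_mul, Real.negMulLog, Real.negMulLog, Real.log_inv]
  ring

theorem integrable_negMulLog_dilatedDensity (hl : 0 < l) (hf : IsProbDensity volume f)
    (hent : Integrable fun t => Real.negMulLog (f t)) :
    Integrable fun t => Real.negMulLog (dilatedDensity l f t) := by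
  simp only [negMulLog_dilatedDensity]
  exact integrable_inv_mul_comp_inv_mul hl (hent.add (hf.integrable.const_mul (Real.log l)))

theorem densityEntropy_dilatedDensity (hl : 0 < l) (hf : IsProbDensity volume f)
    (hent : Integrable fun t => Real.negMulLog (f t)) :
    densityEntropy volume (dilatedDensity l f) = densityEntropy volume f + Real.log l := by
  simp only [densityEntropy, negMulLog_dilatedDensity]
  rw [integral_inv_mul_comp_inv_mul hl fun t => Real.negMulLog (f t) + Real.log l * f t,
    integral_add hent (hf.integrable.const_mul _), integral_const_mul, hf.integral_eq_one, mul_one]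

theorem IsProbDensity.dilatedDensity (hl : 0 < l) (hf : IsProbDensity volume f) :
    IsProbDensity volume (dilatedDensity l f) where
  measurable := (hf.measurable.comp (measurable_const_mul _)).const_mul _
  nonneg _ := mul_nonneg (inv_nonneg.2 hl.le) (hf.nonneg _)
  integral_eq_one := (integral_inv_mul_comp_inv_mul hl f).trans hf.integral_eq_one

theorem IsAdmissible.dilatedDensity (hV : IsOrlicz V) (hl : 0 < l) (hl1 : l ≤ 1)
    (hf : IsAdmissible V R f) : IsAdmissible V (l * R) (dilatedDensity l f) := by
  have hle : ∀ t, V (l * t) * f t ≤ l * (V t * f t) := fun t => by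
    rw [← mul_assoc]
    exact mul_le_mul_of_nonneg_right (hV.apply_mul_le hl.le hl1 t) (hf.nonneg t)
  have hint : Integrable fun t => V (l * t) * f t := by
    have := hV.continuous
    refine (hf.integrable_mul.const_mul l).mono'
      ((by fun_prop : Continuous fun t => V (l * t)).measurable.fun_mul
        hf.measurable).aestronglyMeasurable (ae_of_all _ fun t => ?_)
    rw [Real.norm_of_nonneg (mul_nonneg (hV.nonneg _) (hf.nonneg t))]
    exact hle t
  refine ⟨hf.toIsProbDensity.dilatedDensity hl, integrable_mul_dilatedDensity hl hint, ?_,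
    integrable_negMulLog_dilatedDensity hl hf.toIsProbDensity hf.integrable_negMulLog⟩
  calc ∫ t, V t * _root_.dilatedDensity l f t = ∫ t, V (l * t) * f t :=
        integral_mul_dilatedDensity hl
    _ ≤ ∫ t, l * (V t * f t) := integral_mono hint (hf.integrable_mul.const_mul l) hle
    _ = l * ∫ t, V t * f t := integral_const_mul _ _
    _ ≤ l * R := mul_le_mul_of_nonneg_left hf.integral_mul_le hl.le

theorem IsAdmissible.tendsto_integral_mul_dilatedDensity (hV : IsOrlicz V) (hwc : Continuous w)
    (hw : w =o[cocompact ℝ] V) (hf : IsAdmissible V R f) :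
    Tendsto (fun l => ∫ t, w t * _root_.dilatedDensity l f t) (𝓝[<] 1) (𝓝 (∫ t, w t * f t)) := by
  obtain ⟨C, hC⟩ := hV.exists_abs_le_mul_add hwc hw one_pos
  have hIoo : ∀ᶠ l in 𝓝[<] (1 : ℝ), l ∈ Set.Ioo (0 : ℝ) 1 := Ioo_mem_nhdsLT one_pos
  have hlim : Tendsto (fun l => ∫ t, w (l * t) * f t) (𝓝[<] 1) (𝓝 (∫ t, w t * f t)) := by
    refine tendsto_integral_filter_of_dominated_convergence (fun t => V t * f t + C * f t)
      (Eventually.of_forall fun l => ?_) (hIoo.mono fun l hl => ae_of_all _ fun t => ?_)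
      (hf.integrable_mul.add (hf.integrable.const_mul C)) (ae_of_all _ fun t => ?_)
    · exact ((by fun_prop : Continuous fun t => w (l * t)).measurable.fun_mul
        hf.measurable).aestronglyMeasurable
    · have hVl : V (l * t) ≤ V t := (hV.apply_mul_le hl.1.le hl.2.le t).trans
        (mul_le_of_le_one_left (hV.nonneg t) hl.2.le)
      rw [norm_mul, Real.norm_eq_abs, Real.norm_of_nonneg (hf.nonneg t), ← add_mul]
      exact mul_le_mul_of_nonneg_right (by linarith [hC (l * t)]) (hf.nonneg t)
    · have hcont : Continuous fun l => w (l * t) * f t := by fun_prop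
      simpa using (hcont.tendsto 1).mono_left nhdsWithin_le_nhds
  exact hlim.congr' (hIoo.mono fun l hl => (integral_mul_dilatedDensity hl.1).symm)

/-- Shrinking `f` slightly gains room in the energy constraint, which makes it an open condition. -/
theorem IsAdmissible.exists_lt_isAdmissible (hV : IsOrlicz V) (hwc : Continuous w)
    (hw : w =o[cocompact ℝ] V) (hR : 0 < R) (hf : IsAdmissible V R f) {G : Set ℝ} (hG : IsOpen G)
    (hfG : ∫ t, w t * f t ∈ G) {c : ℝ} (hc : c < densityEntropy volume f) :
    ∃ R' < R, ∃ g, IsAdmissible V R' g ∧ ∫ t, w t * g t ∈ G ∧ c < densityEntropy volume g := by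
  have hlog : Tendsto (fun l => densityEntropy volume f + Real.log l) (𝓝[<] 1)
      (𝓝 (densityEntropy volume f)) := by
    simpa using ((Real.continuousAt_log one_ne_zero).tendsto.const_add
      (densityEntropy volume f)).mono_left nhdsWithin_le_nhds
  have hIoo : ∀ᶠ l in 𝓝[<] (1 : ℝ), l ∈ Set.Ioo (0 : ℝ) 1 := Ioo_mem_nhdsLT one_pos
  obtain ⟨l, hlG, hlc, hl0, hl1⟩ := (((hf.tendsto_integral_mul_dilatedDensity hV hwc hw).eventually
    (hG.mem_nhds hfG)).and ((hlog.eventually_const_lt hc).and hIoo)).exists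
  refine ⟨l * R, mul_lt_of_lt_one_left hR hl1, _, hf.dilatedDensity hV hl0 hl1.le, hlG, ?_⟩
  rwa [densityEntropy_dilatedDensity hl0 hf.toIsProbDensity hf.integrable_negMulLog]

end Dilation

/-! ### The average marginal of a uniform distribution -/

section AverageMarginal

variable {ι α : Type*} [Fintype ι] [MeasurableSpace α]

/-- The average of the one-dimensional marginals of a measure on `ι → α`. For the uniform
distribution on an Orlicz ball it turns the constraint on the ball into a moment constraint. -/
noncomputable def averageMarginal (μ : Measure (ι → α)) : Measure α :=
  (Fintype.card ι : ℝ≥0∞)⁻¹ • ∑ i, μ.map (Function.eval i)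

variable {μ : Measure (ι → α)} {φ : α → ℝ}

theorem isProbabilityMeasure_averageMarginal [Nonempty ι] [IsProbabilityMeasure μ] :
    IsProbabilityMeasure (averageMarginal μ) := by
  have hmap : ∀ i, μ.map (Function.eval i) Set.univ = 1 := fun i =>
    (Measure.isProbabilityMeasure_map (measurable_pi_apply i).aemeasurable).measure_univ
  constructor
  simp only [averageMarginal, Measure.smul_apply, Measure.finsetSum_apply, hmap, Finset.sum_const,
    Finset.card_univ, nsmul_eq_mul, mul_one, smul_eq_mul]
  exact ENNReal.inv_mul_cancel (Nat.cast_ne_zero.2 Fintype.card_ne_zero) (ENNReal.natCast_ne_top _)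

theorem integrable_map_eval_of_integrable_averageMarginal
    (hφ : Integrable φ (averageMarginal μ)) (i : ι) : Integrable φ (μ.map (Function.eval i)) := by
  have : Nonempty ι := ⟨i⟩
  rw [averageMarginal, integrable_smul_measure (by simp) (by simp),
    integrable_finsetSum_measure] at hφ
  exact hφ i (Finset.mem_univ i)

theorem integrable_comp_eval_of_integrable_averageMarginal
    (hφ : Integrable φ (averageMarginal μ)) (i : ι) : Integrable (fun x => φ (x i)) μ :=
  (integrable_map_eval_of_integrable_averageMarginal hφ i).comp_measurable (measurable_pi_apply i)

theorem integral_sum_comp_eval_eq_card_mul (hφ : Integrable φ (averageMarginal μ)) :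
    ∫ x, ∑ i, φ (x i) ∂μ = Fintype.card ι * ∫ t, φ t ∂averageMarginal μ := by
  cases isEmpty_or_nonempty ι
  · simp
  have hmap := integrable_map_eval_of_integrable_averageMarginal hφ
  rw [averageMarginal, integral_smul_measure, integral_finsetSum_measure fun i _ => hmap i,
    integral_finsetSum _ fun i _ => integrable_comp_eval_of_integrable_averageMarginal hφ i,
    ENNReal.toReal_inv, ENNReal.toReal_natCast, smul_eq_mul,
    mul_inv_cancel_left₀ (Nat.cast_ne_zero.2 Fintype.card_ne_zero)]
  exact Finset.sum_congr rfl fun i _ =>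
    (integral_map (measurable_pi_apply i).aemeasurable (hmap i).aestronglyMeasurable).symm

theorem ae_forall_eval_of_ae_averageMarginal {P : α → Prop}
    (h : ∀ᵐ t ∂averageMarginal μ, P t) : ∀ᵐ x ∂μ, ∀ i, P (x i) := by
  rw [averageMarginal, Measure.ae_ennreal_smul_measure_iff (by simp),
    ae_finsetSum_measure_iff] at h
  exact ae_all_iff.2 fun i =>
    ae_of_ae_map (measurable_pi_apply i).aemeasurable (h i (Finset.mem_univ i))

end AverageMarginal

section Subadditivity

variable {ι α : Type*} [Fintype ι] [MeasurableSpace α] {ρ : Measure α} [SigmaFinite ρ] {f : α → ℝ}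
  {A : Set (ι → α)} {K : Set α}

theorem setIntegral_prod_le_one (hf : IsProbDensity ρ f) :
    ∫ x in A, ∏ i, f (x i) ∂Measure.pi (fun _ : ι => ρ) ≤ 1 := by
  calc _ ≤ ∫ x, ∏ i, f (x i) ∂Measure.pi (fun _ : ι => ρ) :=
        setIntegral_le_integral (.fintype_prod fun _ => hf.integrable)
          (ae_of_all _ fun x => Finset.prod_nonneg fun i _ => hf.nonneg _)
    _ = 1 := by rw [integral_fintype_prod_eq_pow, hf.integral_eq_one, one_pow]

theorem measureReal_mul_integral_cond {E : Type*} [MeasurableSpace E] {μ : Measure E} {B : Set E}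
    (hB : μ.real B ≠ 0) (g : E → ℝ) : μ.real B * ∫ x, g x ∂μ[|B] = ∫ x in B, g x ∂μ := by
  rw [ProbabilityTheory.cond, integral_smul_measure, ENNReal.toReal_inv, smul_eq_mul,
    ← Measure.real, mul_inv_cancel_left₀ hB]

theorem log_measure_le_card_mul_densityEntropy (hA0 : Measure.pi (fun _ : ι => ρ) A ≠ 0)
    (hA : Measure.pi (fun _ : ι => ρ) A ≠ ∞) (hf : IsProbDensity ρ f)
    (hent : Integrable (fun t => Real.negMulLog (f t)) ρ)
    (hmarg : averageMarginal (Measure.pi (fun _ : ι => ρ))[|A]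
      = ρ.withDensity fun t => ENNReal.ofReal (f t)) :
    Real.log ((Measure.pi fun _ : ι => ρ).real A) ≤ Fintype.card ι * densityEntropy ρ f := by
  set π := Measure.pi fun _ : ι => ρ
  have hv : 0 < π.real A := ENNReal.toReal_pos hA0 hA
  have : IsProbabilityMeasure π[|A] := cond_isProbabilityMeasure_of_finite hA0 hA
  have hlog : ∀ t, Real.log (f t) * f t = -Real.negMulLog (f t) := fun t => by
    rw [Real.negMulLog]
    ring
  have ilog : Integrable (fun t => Real.log (f t)) (averageMarginal π[|A]) := by
    rw [hmarg, hf.integrable_withDensity_iff]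
    simpa only [hlog] using hent.fun_neg
  have isum := integrable_finsetSum Finset.univ fun i _ =>
    integrable_comp_eval_of_integrable_averageMarginal ilog i
  have iprod : Integrable (fun x => ∏ i, f (x i)) π[|A] :=
    (Integrable.fintype_prod fun _ => hf.integrable).restrict.smul_measure
      (ENNReal.inv_ne_top.2 hA0)
  have hpos : ∀ᵐ x ∂π[|A], ∀ i, 0 < f (x i) := by
    refine ae_forall_eval_of_ae_averageMarginal (P := fun t => 0 < f t) ?_
    rw [hmarg, ae_withDensity_iff hf.measurable.ennreal_ofReal]
    exact ae_of_all _ fun t ht => ENNReal.ofReal_pos.1 (pos_iff_ne_zero.2 ht)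
  have hle : ∫ x, (∑ i, Real.log (f (x i)) + Real.log (π.real A)) ∂π[|A]
      ≤ ∫ x, (π.real A * ∏ i, f (x i) - 1) ∂π[|A] := by
    refine integral_mono_ae (isum.add (integrable_const _))
      ((iprod.const_mul _).sub (integrable_const _)) (hpos.mono fun x hx => ?_)
    have hprod : 0 < ∏ i, f (x i) := Finset.prod_pos fun i _ => hx i
    have h := Real.log_le_sub_one_of_pos (mul_pos hv hprod)
    rwa [Real.log_mul hv.ne' hprod.ne', Real.log_prod fun i _ => (hx i).ne', add_comm] at h
  rw [integral_add isum (integrable_const _), integral_sum_comp_eval_eq_card_mul ilog, hmarg,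
    hf.integral_withDensity, integral_sub (iprod.const_mul _) (integrable_const _),
    integral_const_mul, measureReal_mul_integral_cond hv.ne'] at hle
  simp only [hlog, integral_neg, integral_const, probReal_univ, one_smul] at hle
  rw [densityEntropy]
  linarith [setIntegral_prod_le_one (A := A) hf]

theorem map_eval_restrict_pi_le (hAK : A ⊆ Set.univ.pi fun _ => K) (i : ι) :
    ((Measure.pi fun _ : ι => ρ).restrict A).map (Function.eval i)
      ≤ ρ K ^ (Fintype.card ι - 1) • ρ.restrict K := by
  classical
  calc _ ≤ ((Measure.pi fun _ : ι => ρ).restrict (Set.univ.pi fun _ => K)).map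
        (Function.eval i) :=
        Measure.map_mono (Measure.restrict_mono hAK le_rfl) (measurable_pi_apply i)
    _ = _ := by
      rw [Measure.restrict_pi_pi, Measure.pi_map_eval]
      simp only [Measure.restrict_apply_univ, Finset.prod_const,
        Finset.card_erase_of_mem (Finset.mem_univ i), Finset.card_univ]

theorem averageMarginal_cond_le [Nonempty ι] (hAK : A ⊆ Set.univ.pi fun _ => K) :
    averageMarginal (Measure.pi (fun _ : ι => ρ))[|A]
      ≤ ((Measure.pi (fun _ : ι => ρ) A)⁻¹ * ρ K ^ (Fintype.card ι - 1)) • ρ.restrict K := by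
  have hcard : (Fintype.card ι : ℝ≥0∞) ≠ 0 := Nat.cast_ne_zero.2 Fintype.card_ne_zero
  refine Measure.le_iff'.2 fun S => ?_
  calc _ = (Fintype.card ι : ℝ≥0∞)⁻¹ * ∑ i, (Measure.pi (fun _ : ι => ρ) A)⁻¹
        * ((Measure.pi fun _ : ι => ρ).restrict A).map (Function.eval i) S := by
        simp only [averageMarginal, ProbabilityTheory.cond, Measure.map_smul, Measure.smul_apply,
          Measure.finsetSum_apply, smul_eq_mul]
    _ ≤ (Fintype.card ι : ℝ≥0∞)⁻¹ * ∑ _i : ι, (Measure.pi (fun _ : ι => ρ) A)⁻¹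
        * (ρ K ^ (Fintype.card ι - 1) • ρ.restrict K) S := by
        gcongr with i
        exact map_eval_restrict_pi_le hAK i
    _ = _ := by
        rw [Finset.sum_const, Finset.card_univ, nsmul_eq_mul,
          ENNReal.inv_mul_cancel_left' (fun h => absurd h hcard)
            (fun h => absurd h (ENNReal.natCast_ne_top _)),
          mul_smul, Measure.smul_apply _ (_ • _), smul_eq_mul]

end Subadditivity

section BoundedDensity

variable {α : Type*} [MeasurableSpace α] {ρ ν : Measure α} [SigmaFinite ρ] {C : ℝ≥0∞} {K : Set α}

theorem rnDeriv_le_indicator_of_le_smul_restrict (hK : MeasurableSet K)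
    (hν : ν ≤ C • ρ.restrict K) : ν.rnDeriv ρ ≤ᵐ[ρ] K.indicator fun _ => C := by
  refine ae_le_of_forall_setLIntegral_le_of_sigmaFinite (Measure.measurable_rnDeriv _ _)
    fun S hS _ => ?_
  calc ∫⁻ t in S, ν.rnDeriv ρ t ∂ρ ≤ ν S := Measure.setLIntegral_rnDeriv_le S
    _ ≤ (C • ρ.restrict K) S := hν S
    _ = ∫⁻ t in S, K.indicator (fun _ => C) t ∂ρ := by
      rw [lintegral_indicator_const hK, Measure.restrict_apply hK, Measure.smul_apply,
        Measure.restrict_apply hS, Set.inter_comm, smul_eq_mul]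

theorem integrable_negMulLog_toReal_rnDeriv (hK : MeasurableSet K) (hρK : ρ K ≠ ∞) (hC : C ≠ ∞)
    (hν : ν ≤ C • ρ.restrict K) :
    Integrable (fun t => Real.negMulLog (ν.rnDeriv ρ t).toReal) ρ := by
  obtain ⟨B, hB⟩ := isCompact_Icc.exists_bound_of_continuousOn
    (Real.continuous_negMulLog.continuousOn (s := Set.Icc 0 C.toReal))
  refine Integrable.mono' ((integrable_indicator_iff hK).2 (integrableOn_const (C := B) hρK))
    (Real.continuous_negMulLog.measurable.comp
      (Measure.measurable_rnDeriv _ _).ennreal_toReal).aestronglyMeasurable ?_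
  filter_upwards [rnDeriv_le_indicator_of_le_smul_restrict hK hν] with t ht
  by_cases htK : t ∈ K
  · rw [Set.indicator_of_mem htK] at ht ⊢
    exact hB _ ⟨ENNReal.toReal_nonneg, ENNReal.toReal_mono hC ht⟩
  · rw [Set.indicator_of_notMem htK] at ht ⊢
    simp [nonpos_iff_eq_zero.1 ht]

end BoundedDensity

/-! ### Upper bounds for the volume of parts of Orlicz balls -/

section VolumeUpper

theorem isBounded_orliczBall {V : ℝ → ℝ} (hV : IsOrlicz V) (R : ℝ) (n : ℕ) :
    Bornology.IsBounded (orliczBall V R n) := by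
  have hV1 : 0 < V 1 := hV.pos 1 one_ne_zero
  refine Bornology.forall_isBounded_image_eval_iff.1 fun k =>
    (Metric.isBounded_closedBall (x := (0 : ℝ)) (r := (R * n + V 1) / V 1)).subset ?_
  rintro _ ⟨x, hx, rfl⟩
  have hk : V (x k) ≤ R * n :=
    (Finset.single_le_sum (fun j _ => hV.nonneg (x j)) (Finset.mem_univ k)).trans hx
  rw [mem_closedBall_zero_iff, Real.norm_eq_abs, le_div_iff₀ hV1]
  linarith [hV.mul_abs_le (x k)]

theorem isClosed_orliczBall {V : ℝ → ℝ} (hV : IsOrlicz V) (R : ℝ) (n : ℕ) :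
    IsClosed (orliczBall V R n) := by
  have hVc := hV.continuous
  exact isClosed_le (by fun_prop) continuous_const

theorem exists_averageMarginal_eq_withDensity {ι : Type*} [Fintype ι] [Nonempty ι]
    {A : Set (ι → ℝ)} (hA : Bornology.IsBounded A) (hA0 : volume A ≠ 0) :
    ∃ f : ℝ → ℝ, IsProbDensity volume f ∧ (Integrable fun t => Real.negMulLog (f t)) ∧
      averageMarginal volume[|A] = volume.withDensity (fun t => ENNReal.ofReal (f t)) ∧
      ∀ φ : ℝ → ℝ, Continuous φ → Integrable φ (averageMarginal volume[|A]) := by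
  obtain ⟨L, hL⟩ := hA.subset_closedBall 0
  have hbox : A ⊆ Set.univ.pi fun _ => Metric.closedBall (0 : ℝ) L := fun x hx i _ =>
    mem_closedBall_zero_iff.2 ((norm_le_pi_norm x i).trans (mem_closedBall_zero_iff.1 (hL hx)))
  have hK : volume (Metric.closedBall (0 : ℝ) L) ≠ ∞ := measure_closedBall_lt_top.ne
  have hle := averageMarginal_cond_le (ρ := volume) hbox
  rw [← volume_pi] at hle
  set C := (volume A)⁻¹ * volume (Metric.closedBall (0 : ℝ) L) ^ (Fintype.card ι - 1)
  have hC : C ≠ ∞ := ENNReal.mul_ne_top (ENNReal.inv_ne_top.2 hA0) (ENNReal.pow_ne_top hK)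
  have : IsProbabilityMeasure volume[|A] :=
    cond_isProbabilityMeasure_of_finite hA0 hA.measure_lt_top.ne
  have : IsProbabilityMeasure (averageMarginal volume[|A]) := isProbabilityMeasure_averageMarginal
  have hac : averageMarginal volume[|A] ≪ volume :=
    (Measure.absolutelyContinuous_of_le hle).trans
      ((Measure.restrict_le_self.absolutelyContinuous).smul_left C)
  refine ⟨_, isProbDensity_toReal_rnDeriv hac,
    integrable_negMulLog_toReal_rnDeriv measurableSet_closedBall hK hC hle,
    (withDensity_ofReal_toReal_rnDeriv hac).symm, fun φ hφ => ?_⟩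
  exact ((hφ.continuousOn.integrableOn_compact (isCompact_closedBall 0 L)).smul_measure
    hC).mono_measure hle

variable {V w : ℝ → ℝ} {R s : ℝ} {n : ℕ}

theorem exists_isAdmissible_of_subset_orliczBall (hV : IsOrlicz V) (hwc : Continuous w)
    (hn : n ≠ 0) {A : Set (Fin n → ℝ)} (hAm : MeasurableSet A) (hA0 : volume A ≠ 0)
    (hA : A ⊆ orliczBall V R n) :
    ∃ f, IsAdmissible V R f ∧ ∫ t, w t * f t = ∫ x, (∑ k, w (x k)) / n ∂volume[|A] ∧
      Integrable (fun x => (∑ k, w (x k)) / n) volume[|A] ∧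
      Real.log (volume.real A) ≤ n * densityEntropy volume f := by
  have hAb := (isBounded_orliczBall hV R n).subset hA
  have : Nonempty (Fin n) := ⟨⟨0, Nat.pos_of_ne_zero hn⟩⟩
  have hn0 : (0 : ℝ) < n := Nat.cast_pos.2 (Nat.pos_of_ne_zero hn)
  obtain ⟨f, hf, hent, hmarg, hcont⟩ := exists_averageMarginal_eq_withDensity hAb hA0
  have hint : ∀ {φ : ℝ → ℝ}, Continuous φ → Integrable (fun x => (∑ k, φ (x k)) / n) volume[|A] :=
    fun hφ => (integrable_finsetSum _ fun k _ =>
      integrable_comp_eval_of_integrable_averageMarginal (hcont _ hφ) k).div_const _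
  have havg : ∀ {φ : ℝ → ℝ}, Continuous φ →
      ∫ t, φ t * f t = ∫ x, (∑ k, φ (x k)) / n ∂volume[|A] := fun {φ} hφ => by
    rw [integral_div, integral_sum_comp_eval_eq_card_mul (hcont φ hφ), Fintype.card_fin,
      mul_div_cancel_left₀ _ hn0.ne', hmarg, hf.integral_withDensity]
  have : IsProbabilityMeasure volume[|A] :=
    cond_isProbabilityMeasure_of_finite hA0 hAb.measure_lt_top.ne
  have hVR : ∫ t, V t * f t ≤ R := by
    rw [havg hV.continuous]
    refine (integral_mono_ae (hint hV.continuous) (integrable_const R)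
      ((ae_cond_mem hAm).mono fun x hx => ?_)).trans_eq (by simp)
    exact (div_le_iff₀ hn0).2 (hA hx)
  refine ⟨f, ⟨hf, ?_, hVR, hent⟩, havg hwc, hint hwc, ?_⟩
  · exact hf.integrable_withDensity_iff.1 (hmarg ▸ hcont V hV.continuous)
  · have h := log_measure_le_card_mul_densityEntropy (ρ := volume) hA0 hAb.measure_lt_top.ne hf hent
      hmarg
    rwa [Fintype.card_fin] at h

/-- The points of the Orlicz ball whose empirical mean of the weight `w` lies in `G`. -/
def orliczBallMean (V : ℝ → ℝ) (R : ℝ) (w : ℝ → ℝ) (n : ℕ) (G : Set ℝ) : Set (Fin n → ℝ) :=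
  {x ∈ orliczBall V R n | (∑ k, w (x k)) / n ∈ G}

theorem measurableSet_orliczBallMean (hV : IsOrlicz V) (hwc : Continuous w) {G : Set ℝ}
    (hG : MeasurableSet G) : MeasurableSet (orliczBallMean V R w n G) :=
  (isClosed_orliczBall hV R n).measurableSet.inter
    ((by fun_prop : Continuous fun x : Fin n → ℝ => (∑ k, w (x k)) / n).measurable hG)

theorem volume_orliczBallMean_le_exp (hV : IsOrlicz V) (hwc : Continuous w) (hn : n ≠ 0)
    {I : Set ℝ} (hIc : IsClosed I) (hI : Convex ℝ I)
    (hs : ∀ f, IsAdmissible V R f → ∫ t, w t * f t ∈ I → densityEntropy volume f ≤ s) :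
    volume (orliczBallMean V R w n I) ≤ ENNReal.ofReal (Real.exp (n * s)) := by
  set A := orliczBallMean V R w n I
  rcases eq_or_ne (volume A) 0 with hA0 | hA0
  · exact hA0.le.trans zero_le
  have hAm : MeasurableSet A := measurableSet_orliczBallMean hV hwc hIc.measurableSet
  have hA : A ⊆ orliczBall V R n := fun x hx => hx.1
  have hAtop : volume A ≠ ∞ := ((isBounded_orliczBall hV R n).subset hA).measure_lt_top.ne
  have : IsProbabilityMeasure volume[|A] := cond_isProbabilityMeasure_of_finite hA0 hAtop
  obtain ⟨f, hf, hmean, hint, hlog⟩ := exists_isAdmissible_of_subset_orliczBall hV hwc hn hAm hA0 hA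
  have hfI : ∫ t, w t * f t ∈ I := by
    rw [hmean]
    exact hI.integral_mem hIc ((ae_cond_mem hAm).mono fun x hx => hx.2) hint
  rw [← ENNReal.ofReal_toReal hAtop]
  refine ENNReal.ofReal_le_ofReal ?_
  rw [← Real.log_le_iff_le_exp (ENNReal.toReal_pos hA0 hAtop)]
  exact hlog.trans (mul_le_mul_of_nonneg_left (hs f hf hfI) n.cast_nonneg)

theorem volume_orliczBall_le_exp (hV : IsOrlicz V) (hn : n ≠ 0) {α : ℝ} (hα : α < 0) :
    volume (orliczBall V R n) ≤ ENNReal.ofReal (Real.exp (n * -gibbsDual V R α)) := by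
  have hsub : orliczBall V R n ⊆ orliczBallMean V R V n Set.univ := fun x hx =>
    ⟨hx, Set.mem_univ _⟩
  exact (measure_mono hsub).trans (volume_orliczBallMean_le_exp hV hV.continuous hn isClosed_univ
    convex_univ fun f hf _ => hf.densityEntropy_le_neg_gibbsDual hV hα)

end VolumeUpper

/-! ### Lower bounds for the volume of parts of Orlicz balls -/

section LawOfLargeNumbers

variable {α : Type*} [MeasurableSpace α] {ν : Measure α} [IsProbabilityMeasure ν]

theorem ae_tendsto_average_infinitePi {φ : α → ℝ} (hφ : Measurable φ) (hi : Integrable φ ν) :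
    ∀ᵐ ω ∂(Measure.infinitePi fun _ : ℕ => ν),
      Tendsto (fun n : ℕ => (∑ k : Fin n, φ (ω k)) / n) atTop (𝓝 (∫ t, φ t ∂ν)) := by
  set π := Measure.infinitePi fun _ : ℕ => ν
  have heval (i : ℕ) : MeasurePreserving (fun ω : ℕ → α => ω i) π ν :=
    measurePreserving_eval_infinitePi (fun _ : ℕ => ν) i
  have hindep : iIndepFun (fun (i : ℕ) (ω : ℕ → α) => φ (ω i)) π := iIndepFun_infinitePi fun _ => hφ
  have hident (i : ℕ) : IdentDistrib (fun ω : ℕ → α => φ (ω i)) (fun ω => φ (ω 0)) π π :=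
    IdentDistrib.comp ⟨(heval i).measurable.aemeasurable, (heval 0).measurable.aemeasurable,
      (heval i).map_eq.trans (heval 0).map_eq.symm⟩ hφ
  have hmean : ∫ ω, φ (ω 0) ∂π = ∫ t, φ t ∂ν := by
    rw [← (heval 0).map_eq, integral_map (heval 0).measurable.aemeasurable
      hφ.aestronglyMeasurable]
  filter_upwards [strong_law_ae_real _ ((heval 0).integrable_comp_of_integrable hi)
    (fun i j hij => hindep.indepFun hij) hident] with ω hω
  rw [← hmean]
  exact hω.congr fun n => by rw [Finset.sum_range]

theorem tendsto_pi_setOf_average_mem {ι : Type*} [Finite ι] {φ : ι → α → ℝ}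
    (hφ : ∀ i, Measurable (φ i)) (hi : ∀ i, Integrable (φ i) ν) {U : ι → Set ℝ}
    (hU : ∀ i, IsOpen (U i)) (hmem : ∀ i, ∫ t, φ i t ∂ν ∈ U i) :
    Tendsto (fun n : ℕ => Measure.pi (fun _ : Fin n => ν)
      {x | ∀ i, (∑ k, φ i (x k)) / n ∈ U i}) atTop (𝓝 1) := by
  set S : ∀ n : ℕ, Set (Fin n → α) := fun n => {x | ∀ i, (∑ k, φ i (x k)) / n ∈ U i}
  have hS (n : ℕ) : MeasurableSet (S n) := by
    rw [show S n = ⋂ i, {x | (∑ k, φ i (x k)) / n ∈ U i} from Set.ofPred_forall _]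
    refine MeasurableSet.iInter fun i => ?_
    have hm : Measurable fun x : Fin n → α => (∑ k, φ i (x k)) / n := by fun_prop
    exact hm (hU i).measurableSet
  have hrestr (n : ℕ) : Measurable fun (ω : ℕ → α) (k : Fin n) => ω k := by fun_prop
  set E : ℕ → Set (ℕ → α) := fun n => (fun (ω : ℕ → α) (k : Fin n) => ω k) ⁻¹' S n
  have hae : ∀ᵐ ω ∂(Measure.infinitePi fun _ : ℕ => ν),
      ∀ᶠ n in atTop, (ω ∈ E n ↔ ω ∈ Set.univ) := by
    filter_upwards [ae_all_iff.2 fun i => ae_tendsto_average_infinitePi (hφ i) (hi i)] with ω hω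
    filter_upwards [eventually_all.2 fun i => (hω i).eventually_mem ((hU i).mem_nhds (hmem i))]
      with n hn
    exact iff_of_true hn (Set.mem_univ ω)
  have hlim := tendsto_measure_of_ae_tendsto_indicator_of_isFiniteMeasure atTop MeasurableSet.univ
    (fun n => hrestr n (hS n)) hae
  rw [measure_univ] at hlim
  refine hlim.congr fun n => ?_
  rw [← Measure.infinitePi_eq_pi,
    ← Measure.map_infinitePi_infinitePi_of_inj (P := fun _ : ℕ => ν) (Fin.val_injective (n := n)),
    Measure.map_apply (hrestr n) (hS n)]

end LawOfLargeNumbers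

section Microstates

variable {α : Type*} [MeasurableSpace α] {ρ : Measure α} [SigmaFinite ρ] {f : α → ℝ} {c : ℝ}

theorem pi_withDensity_ofReal {ι : Type*} [Fintype ι] (hf : IsProbDensity ρ f) :
    Measure.pi (fun _ : ι => ρ.withDensity fun t => ENNReal.ofReal (f t))
      = (Measure.pi fun _ : ι => ρ).withDensity fun x => ENNReal.ofReal (∏ i, f (x i)) := by
  have := hf.isProbabilityMeasure_withDensity
  refine Measure.pi_eq fun s hs => ?_
  rw [withDensity_apply _ (MeasurableSet.univ_pi hs), Measure.restrict_pi_pi,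
    ← ofReal_integral_eq_lintegral_ofReal (.fintype_prod fun _ => hf.integrable.restrict)
      (ae_of_all _ fun x => Finset.prod_nonneg fun i _ => hf.nonneg _),
    integral_fintype_prod_eq_prod (fun _ : ι => f),
    ENNReal.ofReal_prod_of_nonneg fun i _ => integral_nonneg hf.nonneg]
  refine Finset.prod_congr rfl fun i _ => ?_
  rw [withDensity_apply _ (hs i),
    ofReal_integral_eq_lintegral_ofReal hf.integrable.restrict (ae_of_all _ hf.nonneg)]

theorem prod_le_exp_neg_of_sum_log_le {ι : Type*} {s : Finset ι} {a : ι → ℝ} (ha : ∀ i ∈ s, 0 ≤ a i)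
    (hc : ∑ i ∈ s, Real.log (a i) ≤ -c) : ∏ i ∈ s, a i ≤ Real.exp (-c) := by
  by_cases hzero : ∃ i ∈ s, a i = 0
  · obtain ⟨i, hi, hai⟩ := hzero
    rw [Finset.prod_eq_zero hi hai]
    exact (Real.exp_pos _).le
  · push Not at hzero
    have hpos : 0 < ∏ i ∈ s, a i := Finset.prod_pos fun i hi => (ha i hi).lt_of_ne' (hzero i hi)
    rwa [← Real.log_le_iff_le_exp hpos, Real.log_prod hzero]

theorem exp_mul_pi_withDensity_le {ι : Type*} [Fintype ι] (hf : IsProbDensity ρ f)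
    {S : Set (ι → α)} (hS : ∀ x ∈ S, ∑ i, Real.log (f (x i)) ≤ -c) :
    ENNReal.ofReal (Real.exp c) *
        Measure.pi (fun _ : ι => ρ.withDensity fun t => ENNReal.ofReal (f t)) S
      ≤ Measure.pi (fun _ : ι => ρ) S := by
  have hle : Measure.pi (fun _ : ι => ρ.withDensity fun t => ENNReal.ofReal (f t)) S
      ≤ ENNReal.ofReal (Real.exp (-c)) * Measure.pi (fun _ : ι => ρ) S := by
    rw [pi_withDensity_ofReal hf, withDensity_apply', ← setLIntegral_const]
    exact setLIntegral_mono measurable_const fun x hx => ENNReal.ofReal_le_ofReal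
      (prod_le_exp_neg_of_sum_log_le (fun i _ => hf.nonneg (x i)) (hS x hx))
  refine (mul_le_mul_right hle _).trans_eq ?_
  rw [← mul_assoc, ← ENNReal.ofReal_mul (Real.exp_pos _).le, ← Real.exp_add, add_neg_cancel,
    Real.exp_zero, ENNReal.ofReal_one, one_mul]

theorem eventually_const_mul_exp_le (C : ℝ) {a b : ℝ} (hab : a < b) :
    ∀ᶠ n : ℕ in atTop, C * Real.exp (n * a) ≤ Real.exp (n * b) := by
  have hlim : Tendsto (fun n : ℕ => Real.exp (n * (b - a))) atTop atTop :=
    Real.tendsto_exp_atTop.comp (tendsto_natCast_atTop_atTop.atTop_mul_const (sub_pos.2 hab))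
  filter_upwards [hlim.eventually_ge_atTop C] with n hn
  refine (mul_le_mul_of_nonneg_right hn (Real.exp_pos _).le).trans_eq ?_
  rw [← Real.exp_add]
  ring_nf

theorem IsProbDensity.eventually_exp_le_pi (hf : IsProbDensity ρ f)
    (hent : Integrable (fun t => Real.negMulLog (f t)) ρ) (hc : c < densityEntropy ρ f)
    {ι : Type*} [Finite ι] {φ : ι → α → ℝ} (hφ : ∀ i, Measurable (φ i))
    (hi : ∀ i, Integrable (fun t => φ i t * f t) ρ) {U : ι → Set ℝ} (hU : ∀ i, IsOpen (U i))
    (hmem : ∀ i, ∫ t, φ i t * f t ∂ρ ∈ U i) :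
    ∀ᶠ n : ℕ in atTop, ENNReal.ofReal (Real.exp (n * c))
      ≤ Measure.pi (fun _ : Fin n => ρ) {x | ∀ i, (∑ k, φ i (x k)) / n ∈ U i} := by
  obtain ⟨c', hcc', hc'⟩ := exists_between hc
  have := hf.isProbabilityMeasure_withDensity
  have hlog (t : α) : Real.log (f t) * f t = -Real.negMulLog (f t) := by
    rw [Real.negMulLog]
    ring
  have hlim := tendsto_pi_setOf_average_mem (ν := ρ.withDensity fun t => ENNReal.ofReal (f t))
    (φ := fun o : Option ι => o.elim (fun t => Real.log (f t)) φ)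
    (U := fun o => o.elim (Set.Iio (-c')) U)
    (Option.forall.2 ⟨hf.measurable.log, hφ⟩)
    (Option.forall.2 ⟨hf.integrable_withDensity_iff.2 (by simpa only [Option.elim, hlog] using
      hent.fun_neg), fun i => hf.integrable_withDensity_iff.2 (hi i)⟩)
    (Option.forall.2 ⟨isOpen_Iio, hU⟩)
    (Option.forall.2 ⟨by
      rw [hf.integral_withDensity]
      simp only [Option.elim, hlog, integral_neg, Set.mem_Iio]
      exact neg_lt_neg hc', fun i => by
      rw [hf.integral_withDensity]
      exact hmem i⟩)
  filter_upwards [hlim.eventually_const_le (u := 2⁻¹) (by simp), eventually_const_mul_exp_le 2 hcc',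
    eventually_gt_atTop 0] with n hhalf hexp hn
  have hsum : ∀ x : Fin n → α, (∑ k, Real.log (f (x k))) / n < -c' →
      ∑ k, Real.log (f (x k)) ≤ -(n * c') := fun x hx => by
    rw [div_lt_iff₀ (Nat.cast_pos.2 hn)] at hx
    linarith
  calc ENNReal.ofReal (Real.exp (n * c))
      ≤ ENNReal.ofReal (Real.exp (n * c')) * 2⁻¹ := by
        rw [← ENNReal.ofReal_ofNat 2, ← ENNReal.ofReal_inv_of_pos two_pos,
          ← ENNReal.ofReal_mul (Real.exp_pos _).le]
        exact ENNReal.ofReal_le_ofReal (by linarith)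
    _ ≤ _ := mul_le_mul_right hhalf _
    _ ≤ _ := exp_mul_pi_withDensity_le hf fun x hx => hsum x (hx none)
    _ ≤ _ := measure_mono fun x hx i => hx (some i)

end Microstates

section VolumeLower

variable {V w f : ℝ → ℝ} {R c : ℝ}

theorem IsAdmissible.eventually_exp_le_volume (hV : IsOrlicz V) (hwc : Continuous w)
    (hw : w =o[cocompact ℝ] V) (hR : 0 < R) (hf : IsAdmissible V R f) {G : Set ℝ} (hG : IsOpen G)
    (hfG : ∫ t, w t * f t ∈ G) (hc : c < densityEntropy volume f) :
    ∀ᶠ n : ℕ in atTop,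
      ENNReal.ofReal (Real.exp (n * c)) ≤ volume (orliczBallMean V R w n G) := by
  obtain ⟨R', hR', g, hg, hgG, hgc⟩ := hf.exists_lt_isAdmissible hV hwc hw hR hG hfG hc
  obtain ⟨C, hC⟩ := hV.exists_abs_le_mul_add hwc hw one_pos
  filter_upwards [hg.eventually_exp_le_pi hg.integrable_negMulLog hgc
    (φ := fun b : Bool => cond b V w) (U := fun b => cond b (Set.Iio R) G)
    (Bool.forall_bool.2 ⟨hwc.measurable, hV.continuous.measurable⟩)
    (Bool.forall_bool.2 ⟨hg.integrable_weight_mul hwc.measurable hC, hg.integrable_mul⟩)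
    (Bool.forall_bool.2 ⟨hG, isOpen_Iio⟩)
    (Bool.forall_bool.2 ⟨hgG, hg.integral_mul_le.trans_lt hR'⟩), eventually_gt_atTop 0]
    with n hn hn0
  refine hn.trans (measure_mono fun x hx => ⟨?_, hx false⟩)
  have hxV : (∑ k, V (x k)) / n < R := hx true
  exact ((div_lt_iff₀ (Nat.cast_pos.2 hn0)).1 hxV).le

theorem eventually_exp_le_volume_orliczBall (hV : IsOrlicz V) (hR : 0 < R) {α : ℝ} (hα : α < 0)
    (hmax : IsMaxOn (gibbsDual V R) (Set.Iio 0) α) (hc : c < -gibbsDual V R α) :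
    ∀ᶠ n : ℕ in atTop, ENNReal.ofReal (Real.exp (n * c)) ≤ volume (orliczBall V R n) := by
  rw [← densityEntropy_gibbsDensity_of_isMaxOn hV hα hmax] at hc
  filter_upwards [(isAdmissible_gibbsDensity_of_isMaxOn hV hα hmax).eventually_exp_le_volume hV
    continuous_zero (Asymptotics.isLittleO_zero _ _) hR isOpen_univ (Set.mem_univ _) hc] with n hn
  exact hn.trans (measure_mono fun x hx => hx.1)

end VolumeLower

/-! ### The rate function -/

section Rate

variable {V : ℝ → ℝ} {p R x : ℝ}

theorem continuous_abs_rpow (hp : 0 ≤ p) : Continuous fun t : ℝ => |t| ^ p :=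
  continuous_abs.rpow_const fun _ => Or.inr hp

theorem exists_coe_le_diffEntropy_of_mem_entropyHypograph (hV : IsOrlicz V) (hp : 0 < p)
    (hVp : (fun t => |t| ^ p) =o[cocompact ℝ] V) (hR : 0 ≤ R) (hx : 0 ≤ x) {c : ℝ}
    (hc : (x ^ p, c) ∈ entropyHypograph V R fun t => |t| ^ p) :
    ∃ ν ∈ entropyConstraint V p R x, (c : EReal) ≤ diffEntropy ν := by
  obtain ⟨f, hf, hmom, hent⟩ := hc
  obtain ⟨C, hC⟩ := hV.exists_abs_le_mul_add (continuous_abs_rpow hp.le) hVp one_pos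
  obtain ⟨ν, hν, hνf⟩ := hf.exists_mem_entropyConstraint hV hp hR hx
    (hf.integrable_weight_mul (continuous_abs_rpow hp.le).measurable hC) hmom
  exact ⟨ν, hν, hνf ▸ EReal.coe_le_coe_iff.2 hent⟩

theorem coe_le_iSup_diffEntropy_iff (hV : IsOrlicz V) (hp : 0 < p)
    (hVp : (fun t => |t| ^ p) =o[cocompact ℝ] V) (hR : 0 ≤ R) (hx : 0 ≤ x) {c : ℝ} :
    (c : EReal) ≤ ⨆ ν ∈ entropyConstraint V p R x, diffEntropy ν ↔
      (x ^ p, c) ∈ entropyHypograph V R fun t => |t| ^ p := by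
  constructor
  · intro hc
    have hclosed : IsClosed {s : ℝ | (x ^ p, s) ∈ entropyHypograph V R fun t => |t| ^ p} :=
      (isClosed_entropyHypograph hV (continuous_abs_rpow hp.le) hVp).preimage (by fun_prop)
    have hsub : Set.Iio c ⊆ {s : ℝ | (x ^ p, s) ∈ entropyHypograph V R fun t => |t| ^ p} := by
      intro s hs
      obtain ⟨ν, hν, hsν⟩ := lt_biSup_iff.1 ((EReal.coe_lt_coe_iff.2 hs).trans_le hc)
      obtain ⟨f, hf, hmom, hent⟩ :=
        exists_isAdmissible_of_mem_entropyConstraint hV hp hR hx hν (ne_bot_of_gt hsν)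
      rw [hent, EReal.coe_lt_coe_iff] at hsν
      exact ⟨f, hf, hmom, hsν.le⟩
    exact closure_minimal hsub hclosed (closure_Iio c ▸ Set.self_mem_Iic)
  · intro hc
    obtain ⟨ν, hν, hcν⟩ := exists_coe_le_diffEntropy_of_mem_entropyHypograph hV hp hVp hR hx hc
    exact hcν.trans (le_biSup diffEntropy hν)

theorem exists_isMaxOn_diffEntropy (hV : IsOrlicz V) (hp : 0 < p)
    (hVp : (fun t => |t| ^ p) =o[cocompact ℝ] V) (hR : 0 ≤ R) (hx : 0 ≤ x)
    (hne : (entropyConstraint V p R x).Nonempty) :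
    ∃ ν ∈ entropyConstraint V p R x, IsMaxOn diffEntropy (entropyConstraint V p R x) ν := by
  have hiff {c : ℝ} := coe_le_iSup_diffEntropy_iff (c := c) hV hp hVp hR hx
  suffices h : ∃ ν ∈ entropyConstraint V p R x,
      ⨆ ν ∈ entropyConstraint V p R x, diffEntropy ν ≤ diffEntropy ν by
    obtain ⟨ν, hν, hle⟩ := h
    exact ⟨ν, hν, fun ν' hν' => (le_biSup diffEntropy hν').trans hle⟩
  induction hs : ⨆ ν ∈ entropyConstraint V p R x, diffEntropy ν with
  | bot => exact hne.imp fun ν hν => ⟨hν, bot_le⟩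
  | coe c => exact exists_coe_le_diffEntropy_of_mem_entropyHypograph hV hp hVp hR hx (hiff.1 hs.ge)
  | top =>
    obtain ⟨f, hf, -, hent⟩ := hiff.1 (hs ▸ le_top : ((-gibbsDual V R (-1) + 1 : ℝ) : EReal) ≤ _)
    linarith [hf.densityEntropy_le_neg_gibbsDual hV neg_one_lt_zero]

theorem neg_coe_sub_le_coe_iff {a b : ℝ} {s : EReal} :
    -(a : EReal) - s ≤ (b : EReal) ↔ ((-a - b : ℝ) : EReal) ≤ s := by
  induction s with
  | bot => exact iff_of_false (by simp [← EReal.coe_neg]) (EReal.bot_lt_coe _).not_ge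
  | coe s =>
    rw [← EReal.coe_neg, ← EReal.coe_sub, EReal.coe_le_coe_iff, EReal.coe_le_coe_iff]
    exact sub_le_comm
  | top => simp [← EReal.coe_neg]

variable {α a : ℝ}

theorem thinShellRate_le_coe_iff (hV : IsOrlicz V) (hp : 0 < p)
    (hVp : (fun t => |t| ^ p) =o[cocompact ℝ] V) (hR : 0 ≤ R) (hα : α < 0)
    (hmax : IsMaxOn (gibbsDual V R) (Set.Iio 0) α) :
    thinShellRate V p R x ≤ (a : EReal) ↔
      0 ≤ x ∧ (x ^ p, -gibbsDual V R α - a) ∈ entropyHypograph V R fun t => |t| ^ p := by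
  by_cases hx : 0 ≤ x
  · have hsup : ⨆ β ∈ Set.Iio (0 : ℝ), (gibbsDual V R β : EReal) = gibbsDual V R α :=
      le_antisymm (iSup₂_le fun β hβ => EReal.coe_le_coe_iff.2 (hmax hβ))
        (le_biSup (fun β => (gibbsDual V R β : EReal)) hα)
    rw [thinShellRate, if_pos hx, hsup, neg_coe_sub_le_coe_iff,
      coe_le_iSup_diffEntropy_iff hV hp hVp hR hx, and_iff_right hx]
  · simp [thinShellRate, hx]

theorem isGoodRateFunction_thinShellRate (hV : IsOrlicz V) (hp : 0 < p)
    (hVp : (fun t => |t| ^ p) =o[cocompact ℝ] V) (hR : 0 < R) :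
    IsGoodRateFunction (thinShellRate V p R) := by
  obtain ⟨α, hα, hmax⟩ := exists_isMaxOn_gibbsDual hV hR
  have hiff {x a : ℝ} :=
    thinShellRate_le_coe_iff (x := x) (a := a) hV hp hVp hR.le (Set.mem_Iio.1 hα) hmax
  refine ⟨fun x => ?_, fun a => Metric.isCompact_of_isClosed_isBounded ?_ ?_⟩
  · by_contra! hneg
    obtain ⟨r, hr, hr0⟩ := EReal.lt_iff_exists_real_btwn.1 hneg
    obtain ⟨-, f, hf, -, hent⟩ := hiff.1 hr.le
    linarith [hf.densityEntropy_le_neg_gibbsDual hV hα, EReal.coe_lt_coe_iff.1 hr0]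
  · simp only [hiff]
    exact isClosed_Ici.inter ((isClosed_entropyHypograph hV (continuous_abs_rpow hp.le)
      hVp).preimage ((Real.continuous_rpow_const hp.le).prodMk continuous_const))
  · obtain ⟨C, hC⟩ := hV.exists_abs_le_mul_add (continuous_abs_rpow hp.le) hVp one_pos
    refine (Metric.isBounded_Icc 0 ((1 * R + C) ^ p⁻¹)).subset fun x hx => ?_
    obtain ⟨hx0, f, hf, hmom, -⟩ := hiff.1 hx
    have hxp : x ^ p ≤ 1 * R + C := hmom.ge.trans <|
      hf.integral_weight_mul_le (continuous_abs_rpow hp.le).measurable zero_le_one hC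
    exact ⟨hx0, (Real.le_rpow_inv_iff_of_pos hx0 ((Real.rpow_nonneg hx0 p).trans hxp) hp).2 hxp⟩

end Rate

/-! ### The large deviation principle -/

section LDP

variable {V w : ℝ → ℝ} {R α a b s : ℝ} {n : ℕ}

theorem coe_le_log_div_natCast_iff (hn : n ≠ 0) {q : ℝ≥0∞} :
    (a : EReal) ≤ ENNReal.log q / (n : EReal) ↔ ENNReal.ofReal (Real.exp (n * a)) ≤ q := by
  have hn0 : (0 : EReal) < (n : EReal) := by exact_mod_cast Nat.pos_of_ne_zero hn
  rw [← ENNReal.log_le_log_iff, ENNReal.log_ofReal_of_pos (Real.exp_pos _), Real.log_exp,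
    EReal.le_div_iff_mul_le hn0 (EReal.natCast_ne_top n), mul_comm]
  norm_cast

theorem log_div_natCast_le_coe_iff (hn : n ≠ 0) {q : ℝ≥0∞} :
    ENNReal.log q / (n : EReal) ≤ (a : EReal) ↔ q ≤ ENNReal.ofReal (Real.exp (n * a)) := by
  have hn0 : (0 : EReal) < (n : EReal) := by exact_mod_cast Nat.pos_of_ne_zero hn
  rw [← ENNReal.log_le_log_iff, ENNReal.log_ofReal_of_pos (Real.exp_pos _), Real.log_exp,
    EReal.div_le_iff_le_mul hn0 (EReal.natCast_ne_top n)]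
  norm_cast

theorem inv_ofReal_exp_mul_ofReal_exp (a b : ℝ) :
    (ENNReal.ofReal (Real.exp a))⁻¹ * ENNReal.ofReal (Real.exp b)
      = ENNReal.ofReal (Real.exp (b - a)) := by
  rw [← ENNReal.ofReal_inv_of_pos (Real.exp_pos a), ← Real.exp_neg,
    ← ENNReal.ofReal_mul (Real.exp_pos _).le, ← Real.exp_add, neg_add_eq_sub]

theorem exists_abs_average_le (hV : IsOrlicz V) (hwc : Continuous w) (hw : w =o[cocompact ℝ] V) :
    ∃ B, ∀ n : ℕ, n ≠ 0 → ∀ x ∈ orliczBall V R n, |(∑ k, w (x k)) / n| ≤ B := by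
  obtain ⟨C, hC⟩ := hV.exists_abs_le_mul_add hwc hw one_pos
  refine ⟨R + C, fun n hn x hx => ?_⟩
  rw [abs_div, Nat.abs_cast, div_le_iff₀ (Nat.cast_pos.2 (Nat.pos_of_ne_zero hn))]
  have hx : ∑ k, V (x k) ≤ R * n := hx
  calc |∑ k, w (x k)| ≤ ∑ k, |w (x k)| := Finset.abs_sum_le_sum_abs _ _
    _ ≤ ∑ k, (1 * V (x k) + C) := Finset.sum_le_sum fun k _ => hC (x k)
    _ = ∑ k, V (x k) + n * C := by simp [Finset.sum_add_distrib]
    _ ≤ (R + C) * n := by linarith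

theorem exists_volume_orliczBallMean_le_natCast_mul_exp (hV : IsOrlicz V) (hwc : Continuous w)
    (hw : w =o[cocompact ℝ] V) {F : Set ℝ} (hF : IsClosed F)
    (hs : ∀ y ∈ F, (y, s) ∉ entropyHypograph V R w) :
    ∃ N : ℕ, ∀ n : ℕ, n ≠ 0 →
      volume (orliczBallMean V R w n F) ≤ N * ENNReal.ofReal (Real.exp (n * s)) := by
  obtain ⟨B, hB⟩ := exists_abs_average_le (R := R) hV hwc hw
  have hK : IsCompact (Metric.closedBall 0 B ∩ F) := (isCompact_closedBall 0 B).inter_right hF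
  have hopen : IsOpen {y | (y, s) ∉ entropyHypograph V R w} :=
    (isClosed_entropyHypograph hV hwc hw).isOpen_compl.preimage (by fun_prop)
  have hnhds : ∀ y ∈ Metric.closedBall 0 B ∩ F, ∃ r > 0,
      Metric.closedBall y r ⊆ {y | (y, s) ∉ entropyHypograph V R w} := fun y hy =>
    Metric.nhds_basis_closedBall.mem_iff.1 (hopen.mem_nhds (hs y hy.2))
  choose! r hr hrs using hnhds
  obtain ⟨T, hTK, hT⟩ := hK.elim_nhds_subcover (fun y => Metric.closedBall y (r y))
    fun y hy => Metric.closedBall_mem_nhds y (hr y hy)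
  refine ⟨T.card, fun n hn => ?_⟩
  have hcover : orliczBallMean V R w n F
      ⊆ ⋃ y ∈ T, orliczBallMean V R w n (Metric.closedBall y (r y)) := fun x hx => by
    obtain ⟨y, hy, hxy⟩ :=
      Set.mem_iUnion₂.1 (hT ⟨mem_closedBall_zero_iff.2 (hB n hn x hx.1), hx.2⟩)
    exact Set.mem_iUnion₂.2 ⟨y, hy, hx.1, hxy⟩
  refine (measure_mono hcover).trans ((measure_biUnion_finset_le T _).trans ?_)
  rw [← nsmul_eq_mul]
  refine Finset.sum_le_card_nsmul _ _ _ fun y hy => ?_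
  refine volume_orliczBallMean_le_exp hV hwc hn Metric.isClosed_closedBall
    (convex_closedBall y (r y)) fun f hf hfy => ?_
  by_contra! hlt
  exact hrs y (hTK y hy) hfy ⟨f, hf, rfl, hlt.le⟩

theorem cond_orliczBall_setOf_average_mem (hV : IsOrlicz V) (G : Set ℝ) :
    volume[|orliczBall V R n] {x | (∑ k, w (x k)) / n ∈ G}
      = (volume (orliczBall V R n))⁻¹ * volume (orliczBallMean V R w n G) :=
  cond_apply (isClosed_orliczBall hV R n).measurableSet _ _

theorem eventually_exp_le_cond_orliczBall (hV : IsOrlicz V) (hwc : Continuous w)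
    (hw : w =o[cocompact ℝ] V) (hR : 0 < R) (hα : α < 0) {G : Set ℝ} (hG : IsOpen G) {y : ℝ}
    (hy : y ∈ G) (hyb : (y, -gibbsDual V R α - b) ∈ entropyHypograph V R w) (hba : b < a) :
    ∀ᶠ n : ℕ in atTop, ENNReal.ofReal (Real.exp (n * -a))
      ≤ volume[|orliczBall V R n] {x | (∑ k, w (x k)) / n ∈ G} := by
  obtain ⟨f, hf, rfl, hent⟩ := hyb
  have hlow := hf.eventually_exp_le_volume hV hwc hw hR hG hy
    (c := -gibbsDual V R α - a) (by linarith)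
  filter_upwards [hlow, eventually_ne_atTop 0] with n hn hn0
  rw [cond_orliczBall_setOf_average_mem hV]
  calc ENNReal.ofReal (Real.exp (n * -a))
      = (ENNReal.ofReal (Real.exp (n * -gibbsDual V R α)))⁻¹ *
          ENNReal.ofReal (Real.exp (n * (-gibbsDual V R α - a))) := by
        rw [inv_ofReal_exp_mul_ofReal_exp]
        ring_nf
    _ ≤ _ := mul_le_mul' (ENNReal.inv_le_inv.2 (volume_orliczBall_le_exp hV hn0 hα)) hn

theorem eventually_cond_orliczBall_le_exp (hV : IsOrlicz V) (hwc : Continuous w)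
    (hw : w =o[cocompact ℝ] V) (hR : 0 < R) (hα : α < 0)
    (hmax : IsMaxOn (gibbsDual V R) (Set.Iio 0) α) {F : Set ℝ} (hF : IsClosed F)
    (hb : ∀ y ∈ F, (y, -gibbsDual V R α - b) ∉ entropyHypograph V R w) (hab : a < b) :
    ∀ᶠ n : ℕ in atTop, volume[|orliczBall V R n] {x | (∑ k, w (x k)) / n ∈ F}
      ≤ ENNReal.ofReal (Real.exp (n * -a)) := by
  obtain ⟨c, hac, hcb⟩ := exists_between hab
  obtain ⟨N, hN⟩ := exists_volume_orliczBallMean_le_natCast_mul_exp hV hwc hw hF hb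
  have hlow := eventually_exp_le_volume_orliczBall hV hR hα hmax
    (c := -gibbsDual V R α - (c - a)) (by linarith)
  have hNexp := eventually_const_mul_exp_le N
    (show -gibbsDual V R α - b < -gibbsDual V R α - c by linarith)
  filter_upwards [hlow, hNexp, eventually_ne_atTop 0] with n hn hnN hn0
  have hup : volume (orliczBallMean V R w n F)
      ≤ ENNReal.ofReal (Real.exp (n * (-gibbsDual V R α - c))) := by
    refine (hN n hn0).trans ?_
    rw [← ENNReal.ofReal_natCast, ← ENNReal.ofReal_mul (Nat.cast_nonneg N)]
    exact ENNReal.ofReal_le_ofReal hnN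
  rw [cond_orliczBall_setOf_average_mem hV]
  refine (mul_le_mul' (ENNReal.inv_le_inv.2 hn) hup).trans_eq ?_
  rw [inv_ofReal_exp_mul_ofReal_exp]
  ring_nf

variable {p : ℝ}

theorem neg_iInf_thinShellRate_le_liminf (hV : IsOrlicz V) (hp : 0 < p)
    (hVp : (fun t => |t| ^ p) =o[cocompact ℝ] V) (hR : 0 < R) {G : Set ℝ} (hG : IsOpen G) :
    -(⨅ x ∈ G, thinShellRate V p R x) ≤ liminf (fun n : ℕ => ENNReal.log
      (volume[|orliczBall V R n] {x | (∑ k, |x k| ^ p) / n ∈ (fun z => z ^ p⁻¹) ⁻¹' G}) /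
        (n : EReal)) atTop := by
  obtain ⟨α, hα, hmax⟩ := exists_isMaxOn_gibbsDual hV hR
  refine le_of_forall_lt_imp_le_of_dense fun d hd => ?_
  obtain ⟨x, hx, hxd⟩ : ∃ x ∈ G, thinShellRate V p R x < -d := by
    simpa only [iInf_lt_iff, exists_prop] using EReal.lt_neg_comm.1 hd
  obtain ⟨b, hxb, hbd⟩ := EReal.lt_iff_exists_real_btwn.1 hxd
  obtain ⟨a, hba, had⟩ := EReal.lt_iff_exists_real_btwn.1 hbd
  obtain ⟨hx0, hmem⟩ := (thinShellRate_le_coe_iff hV hp hVp hR.le hα hmax).1 hxb.le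
  have hxG : x ^ p ∈ (fun z : ℝ => z ^ p⁻¹) ⁻¹' G := by
    rwa [Set.mem_preimage, Real.rpow_rpow_inv hx0 hp.ne']
  have hGp : IsOpen ((fun z : ℝ => z ^ p⁻¹) ⁻¹' G) :=
    hG.preimage (Real.continuous_rpow_const (inv_nonneg.2 hp.le))
  refine le_liminf_of_le (by isBoundedDefault) ?_
  filter_upwards [eventually_exp_le_cond_orliczBall hV (continuous_abs_rpow hp.le) hVp hR hα hGp
    hxG hmem (EReal.coe_lt_coe_iff.1 hba), eventually_ne_atTop 0] with n hn hn0
  exact (EReal.lt_neg_comm.1 had).le.trans ((coe_le_log_div_natCast_iff hn0).2 hn)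

theorem limsup_le_neg_iInf_thinShellRate (hV : IsOrlicz V) (hp : 0 < p)
    (hVp : (fun t => |t| ^ p) =o[cocompact ℝ] V) (hR : 0 < R) {F : Set ℝ} (hF : IsClosed F) :
    limsup (fun n : ℕ => ENNReal.log
      (volume[|orliczBall V R n] {x | (∑ k, |x k| ^ p) / n ∈ (fun z => z ^ p⁻¹) ⁻¹' F}) /
        (n : EReal)) atTop ≤ -(⨅ x ∈ F, thinShellRate V p R x) := by
  obtain ⟨α, hα, hmax⟩ := exists_isMaxOn_gibbsDual hV hR
  refine le_of_forall_gt_imp_ge_of_dense fun d hd => ?_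
  obtain ⟨a, hda, ha⟩ := EReal.lt_iff_exists_real_btwn.1 (EReal.neg_lt_comm.1 hd)
  obtain ⟨b, hab, hb⟩ := EReal.lt_iff_exists_real_btwn.1 ha
  have hFp : IsClosed ((fun z : ℝ => z ^ p⁻¹) ⁻¹' F) :=
    hF.preimage (Real.continuous_rpow_const (inv_nonneg.2 hp.le))
  have hnot : ∀ y ∈ (fun z : ℝ => z ^ p⁻¹) ⁻¹' F,
      (y, -gibbsDual V R α - b) ∉ entropyHypograph V R fun t => |t| ^ p := by
    intro y hy hmem
    have hy0 : 0 ≤ y := by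
      obtain ⟨f, hf, rfl, -⟩ := hmem
      exact integral_nonneg fun t => mul_nonneg (by positivity) (hf.nonneg t)
    refine ((thinShellRate_le_coe_iff hV hp hVp hR.le hα hmax).2
      ⟨Real.rpow_nonneg hy0 p⁻¹, ?_⟩).not_gt (hb.trans_le (iInf₂_le (y ^ p⁻¹) hy))
    rwa [Real.rpow_inv_rpow hy0 hp.ne']
  refine limsup_le_of_le (by isBoundedDefault) ?_
  filter_upwards [eventually_cond_orliczBall_le_exp hV (continuous_abs_rpow hp.le) hVp hR hα hmax
    hFp hnot (EReal.coe_lt_coe_iff.1 hab), eventually_ne_atTop 0] with n hn hn0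
  exact ((log_div_natCast_le_coe_iff hn0).2 hn).trans (EReal.neg_lt_comm.1 hda).le

theorem rpow_neg_mul_norm_toLp (hp : 0 < p) (x : Fin n → ℝ) :
    (n : ℝ) ^ (-(1 / p)) *
        ‖(WithLp.toLp (ENNReal.ofReal p) x : PiLp (ENNReal.ofReal p) fun _ : Fin n => ℝ)‖
      = ((∑ k, |x k| ^ p) / n) ^ p⁻¹ := by
  have hp' : (ENNReal.ofReal p).toReal = p := ENNReal.toReal_ofReal hp.le
  rw [PiLp.norm_eq_sum (by rwa [hp']), hp', one_div, Real.rpow_neg n.cast_nonneg,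
    Real.div_rpow (Finset.sum_nonneg fun k _ => by positivity) n.cast_nonneg, div_eq_inv_mul]
  rfl

theorem measure_preimage_rpow_neg_mul_norm (hp : 0 < p) {Ω : Type*} [MeasurableSpace Ω]
    {P : Measure Ω} {X : Ω → Fin n → ℝ} (hXm : Measurable X)
    (hX : pdf.IsUniform X (orliczBall V R n) P volume) {A : Set ℝ} (hA : MeasurableSet A) :
    P ((fun ω => (n : ℝ) ^ (-(1 / p)) *
        ‖(WithLp.toLp (ENNReal.ofReal p) (X ω) : PiLp (ENNReal.ofReal p) fun _ : Fin n => ℝ)‖)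
          ⁻¹' A)
      = volume[|orliczBall V R n] {x | (∑ k, |x k| ^ p) / n ∈ (fun z => z ^ p⁻¹) ⁻¹' A} := by
  have hmap : P.map X = volume[|orliczBall V R n] := hX
  have hmean : Measurable fun x : Fin n → ℝ => ((∑ k, |x k| ^ p) / n) ^ p⁻¹ := by fun_prop
  simp only [rpow_neg_mul_norm_toLp hp]
  change P (X ⁻¹' ((fun x : Fin n → ℝ => ((∑ k, |x k| ^ p) / n) ^ p⁻¹) ⁻¹' A)) = _
  rw [← Measure.map_apply hXm (hmean hA), hmap]
  rfl

theorem satisfiesLDP_thinShellRate (hV : IsOrlicz V) (hp : 0 < p)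
    (hVp : (fun t => |t| ^ p) =o[cocompact ℝ] V) (hR : 0 < R)
    {Ω : ℕ → Type*} [∀ n, MeasurableSpace (Ω n)] {P : ∀ n, Measure (Ω n)}
    {X : ∀ n, Ω n → (Fin n → ℝ)} (hXm : ∀ n, Measurable (X n))
    (hX : ∀ n, 1 ≤ n → pdf.IsUniform (X n) (orliczBall V R n) (P n) volume) :
    SatisfiesLDP P
      (fun n ω => (n : ℝ) ^ (-(1 / p)) *
        ‖(WithLp.toLp (ENNReal.ofReal p) (X n ω) : PiLp (ENNReal.ofReal p) fun _ : Fin n => ℝ)‖)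
      (thinShellRate V p R) where
  isGoodRateFunction := isGoodRateFunction_thinShellRate hV hp hVp hR
  lower A _ := by
    refine (neg_iInf_thinShellRate_le_liminf hV hp hVp hR isOpen_interior).trans_eq
      (liminf_congr ((eventually_ge_atTop 1).mono fun n hn => ?_))
    rw [measure_preimage_rpow_neg_mul_norm hp (hXm n) (hX n hn) isOpen_interior.measurableSet]
  upper A _ := by
    refine Eq.trans_le (limsup_congr ((eventually_ge_atTop 1).mono fun n hn => ?_))
      (limsup_le_neg_iInf_thinShellRate hV hp hVp hR isClosed_closure)
    rw [measure_preimage_rpow_neg_mul_norm hp (hXm n) (hX n hn) isClosed_closure.measurableSet]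

end LDP

theorem mainTheorem5_general
    (V : ℝ → ℝ) (hV : IsOrlicz V) (p : ℝ) (hp : 0 < p)
    (hVp : Tendsto (fun x : ℝ => V x / |x| ^ p) (cocompact ℝ) atTop)
    (R : ℝ) (hR : 0 < R)
    {Ω : ℕ → Type*} [∀ n, MeasurableSpace (Ω n)] (P : ∀ n, Measure (Ω n))
    (X : ∀ n, Ω n → (Fin n → ℝ)) (hXm : ∀ n, Measurable (X n))
    (hX : ∀ n, 1 ≤ n → pdf.IsUniform (X n) (orliczBall V R n) (P n) volume) :
    (∃ α ∈ Set.Iio (0 : ℝ), IsMaxOn (gibbsDual V R) (Set.Iio 0) α) ∧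
    (∀ x : ℝ, 0 ≤ x → (entropyConstraint V p R x).Nonempty →
      ∃ ν ∈ entropyConstraint V p R x, IsMaxOn diffEntropy (entropyConstraint V p R x) ν) ∧
    SatisfiesLDP P
      (fun n ω => (n : ℝ) ^ (-(1 / p)) *
        ‖(WithLp.toLp (ENNReal.ofReal p) (X n ω) : PiLp (ENNReal.ofReal p) fun _ : Fin n => ℝ)‖)
      (thinShellRate V p R) := by
  have hVp := hV.isLittleO_abs_rpow hVp
  exact ⟨exists_isMaxOn_gibbsDual hV hR,
    fun _ hx hne => exists_isMaxOn_diffEntropy hV hp hVp hR.le hx hne,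
    satisfiesLDP_thinShellRate hV hp hVp hR hXm hX⟩

theorem mainTheorem5
    (V : ℝ → ℝ) (hV : IsOrlicz V) (p : ℝ) (hp : 1 < p)
    (hVp : Tendsto (fun x : ℝ => V x / |x| ^ p) (cocompact ℝ) atTop)
    (R : ℝ) (hR : 0 < R)
    {Ω : ℕ → Type*} [∀ n, MeasurableSpace (Ω n)]
    (P : ∀ n, Measure (Ω n)) [∀ n, IsProbabilityMeasure (P n)]
    (X : ∀ n, Ω n → (Fin n → ℝ)) (hXm : ∀ n, Measurable (X n))
    (hX : ∀ n, 1 ≤ n → pdf.IsUniform (X n) (orliczBall V R n) (P n) volume) :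
    (∃ α ∈ Set.Iio (0 : ℝ), IsMaxOn (gibbsDual V R) (Set.Iio 0) α) ∧
    (∀ x : ℝ, 0 ≤ x → (entropyConstraint V p R x).Nonempty →
      ∃ ν ∈ entropyConstraint V p R x, IsMaxOn diffEntropy (entropyConstraint V p R x) ν) ∧
    SatisfiesLDP P
      (fun n ω => (n : ℝ) ^ (-(1 / p)) *
        ‖(WithLp.toLp (ENNReal.ofReal p) (X n ω) : PiLp (ENNReal.ofReal p) fun _ : Fin n => ℝ)‖)
      (thinShellRate V p R) :=
  mainTheorem5_general V hV p (one_pos.trans hp) hVp R hR P X hXm hX
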